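/- Let $n\ge 0$ be an integer and $\lambda\in\mathbb R$. Put $\eta_\lambda(r)=\frac{e^{2\lambda r}-1}{2\lambda}$ for $\lambda\neq0$ and $\eta_0(r)=r$, let $\bar e(t)=e^{-2\pi i t}$, and let $\beta$ be the usual inner product on $\mathbb R^n$. Let $\mathcal H=L^2(\mathbb R^n\times\mathbb R^n\times\mathbb R)$ (Lebesgue measure, variables $(x,y,r)$), identify $\mathcal H\otimes\mathcal H$ with $L^2$ of the variables $(x,y,r,x',y',r')$, and let $\Sigma$ be the flip on $\mathcal H\otimes\mathcal H$. Define the operator $U_A$ on $\mathcal H\otimes\mathcal H$ by $$U_A\xi(x,y,r,x',y',r')=(e^{-\lambda r'})^n\,\bar e\bigl[\eta_\lambda(r')\beta(e^{-\lambda r'}x,\,y'-e^{-\lambda r'}y)\bigr]\,\xi(e^{-\lambda r'}x,e^{-\lambda r'}y,r+r',\,x'-e^{-\lambda r'}x,y'-e^{-\lambda r'}y,r'),$$ and the operators $j$ (linear) and $J,\hat J$ (conjugate-linear) on $\mathcal H$ by $$j\xi(x,y,r)=(e^{\lambda r})^n\,\bar e\bigl[\eta_\lambda(r)\beta(x,y)\bigr]\,\xi(-e^{\lambda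 r}x,-e^{\lambda r}y,-r),$$ $$J\xi(x,y,r)=\bar e\bigl[\eta_\lambda(r)\beta(x,y)\bigr]\,\overline{\xi(-x,-y,r)},\qquad \hat J\xi(x,y,r)=(e^{\lambda r})^n\,\overline{\xi(e^{\lambda r}x,e^{\lambda r}y,-r)}.$$ For an operator $X$ on $\mathcal H\otimes\mathcal H$ put $$\widehat X=\Sigma(j\otimes1)X(j\otimes1)\Sigma,\qquad \widetilde X=(j\otimes1)(\Sigma X\Sigma)(j\otimes1).$$ A regular multiplicative unitary on a Hilbert space $H$ (in the sense of Baaj and Skandalis) is a unitary $V\in\mathcal B(H\otimes H)$ with $V_{12}V_{13}V_{23}=V_{23}V_{12}$ such that the norm closure of $\{(\mathrm{id}\otimes\omega)(\Sigma V):\omega\in\mathcal B(H)_*\}$ is the algebra of compact operators on $H$. A Kac system is a triple $(H,V,u)$ where $V\in\mathcal B(H\otimes H)$, $u\in\mathcal B(H)$ is unitary, $u^2=1$, the operators $V$, $\Sigma(u\otimes1)V(u\otimes1)\Sigma$ and $(u\otimes u)\Sigma(u\otimes1)V(u\otimes1)\Sigma(u\otimes u)$ are regular multiplicative unitaries, and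 $(\Sigma(1\otimes u)V)^3=1$. Then: 1. $j=\hat JJ=J\hat J$. 2. $\widehat{\widehat{U_A}}=\widetilde{\widetilde{U_A}}=(j\otimes j)U_A(j\otimes j)$. 3. The operators $U_A$, $\widehat{U_A}$, $\widetilde{U_A}$ and $(j\otimes j)U_A(j\otimes j)$ are regular multiplicative unitaries, and so is $\Sigma X^*\Sigma$ for each of these four operators $X$. 4. $(\mathcal H,U_A,j)$ is a Kac system (in particular, $j$ is unitary and $j^2=1$). -/

import Mathlib

open MeasureTheory
open scoped TensorProduct ENNReal InnerProductSpace ComplexConjugate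

noncomputable section

/-! ### Hilbert space tensor products -/

section HilbertTensor

variable (H K L : Type*) [NormedAddCommGroup H] [InnerProductSpace ℂ H]
  [NormedAddCommGroup K] [InnerProductSpace ℂ K] [NormedAddCommGroup L] [InnerProductSpace ℂ L]

/-- The Hilbert space tensor product: the completion of the algebraic tensor product for the
inner product `⟪x ⊗ y, x' ⊗ y'⟫ = ⟪x, x'⟫ ⟪y, y'⟫`. -/
def HilbertTensor : Type _ := UniformSpace.Completion (H ⊗[ℂ] K)

instance : NormedAddCommGroup (HilbertTensor H K) :=
  inferInstanceAs (NormedAddCommGroup (UniformSpace.Completion (H ⊗[ℂ] K)))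

instance : InnerProductSpace ℂ (HilbertTensor H K) :=
  inferInstanceAs (InnerProductSpace ℂ (UniformSpace.Completion (H ⊗[ℂ] K)))

instance : CompleteSpace (HilbertTensor H K) :=
  inferInstanceAs (CompleteSpace (UniformSpace.Completion (H ⊗[ℂ] K)))

/-- The dense isometric inclusion of the algebraic tensor product. -/
def tensorIncl : H ⊗[ℂ] K →ₗᵢ[ℂ] HilbertTensor H K :=
  UniformSpace.Completion.toComplₗᵢ (𝕜 := ℂ) (E := H ⊗[ℂ] K)

theorem denseRange_tensorIncl : DenseRange (tensorIncl H K) :=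
  UniformSpace.Completion.denseRange_coe (α := H ⊗[ℂ] K)

variable {H K L} in
/-- The operator `S ⊗ T` on the Hilbert space tensor product. -/
def tensorOp {H' K' : Type*} [NormedAddCommGroup H'] [InnerProductSpace ℂ H']
    [NormedAddCommGroup K'] [InnerProductSpace ℂ K'] (S : H →L[ℂ] H') (T : K →L[ℂ] K') :
    HilbertTensor H K →L[ℂ] HilbertTensor H' K' :=
  ((tensorIncl H' K').toContinuousLinearMap ∘L TensorProduct.mapL S T).extend
    (tensorIncl H K).toContinuousLinearMap

variable {H K L} in
theorem tensorOp_tmul {H' K' : Type*} [NormedAddCommGroup H'] [InnerProductSpace ℂ H']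
    [NormedAddCommGroup K'] [InnerProductSpace ℂ K'] (S : H →L[ℂ] H') (T : K →L[ℂ] K')
    (x : H) (y : K) :
    tensorOp S T (tensorIncl H K (x ⊗ₜ y)) = tensorIncl H' K' (S x ⊗ₜ T y) :=
  ContinuousLinearMap.extend_eq
    ((tensorIncl H' K').toContinuousLinearMap ∘L TensorProduct.mapL S T)
    (e := (tensorIncl H K).toContinuousLinearMap) (denseRange_tensorIncl H K)
    (tensorIncl H K).isometry.isUniformInducing (x ⊗ₜ[ℂ] y)

/-- The flip `x ⊗ y ↦ y ⊗ x`. -/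
def flipOp : HilbertTensor H K →L[ℂ] HilbertTensor K H :=
  ((tensorIncl K H).comp
    (TensorProduct.commIsometry ℂ H K).toLinearIsometry).toContinuousLinearMap.extend
      (tensorIncl H K).toContinuousLinearMap

theorem flipOp_tmul (x : H) (y : K) :
    flipOp H K (tensorIncl H K (x ⊗ₜ y)) = tensorIncl K H (y ⊗ₜ x) :=
  ContinuousLinearMap.extend_eq ((tensorIncl K H).comp
    (TensorProduct.commIsometry ℂ H K).toLinearIsometry).toContinuousLinearMap
    (e := (tensorIncl H K).toContinuousLinearMap) (denseRange_tensorIncl H K)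
    (tensorIncl H K).isometry.isUniformInducing (x ⊗ₜ[ℂ] y)

/-- The map `y ↦ x ⊗ y`, linear and continuous in `x` and in `y`. -/
def leftTensor : H →L[ℂ] K →L[ℂ] HilbertTensor H K :=
  (ContinuousLinearMap.compL ℂ K (H ⊗[ℂ] K) (HilbertTensor H K)
    (tensorIncl H K).toContinuousLinearMap) ∘L TensorProduct.mkL ℂ H K

theorem leftTensor_apply (x : H) (y : K) : leftTensor H K x y = tensorIncl H K (x ⊗ₜ y) := rfl

/-- The map from the algebraic triple tensor product `(H ⊗ K) ⊗ L` to the Hilbert space one. -/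
def tripleLeft : (H ⊗[ℂ] K) ⊗[ℂ] L →ₗᵢ[ℂ] HilbertTensor (HilbertTensor H K) L :=
  (tensorIncl _ _).comp (TensorProduct.mapIsometry (tensorIncl H K) LinearIsometry.id)

/-- The map from the algebraic triple tensor product `H ⊗ (K ⊗ L)` to the Hilbert space one. -/
def tripleRight : H ⊗[ℂ] (K ⊗[ℂ] L) →ₗᵢ[ℂ] HilbertTensor H (HilbertTensor K L) :=
  (tensorIncl _ _).comp (TensorProduct.mapIsometry LinearIsometry.id (tensorIncl K L))

variable {H K L} in
theorem denseRange_map {H' K' : Type*} [NormedAddCommGroup H'] [InnerProductSpace ℂ H']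
    [NormedAddCommGroup K'] [InnerProductSpace ℂ K'] (f : H →ₗᵢ[ℂ] H') (g : K →ₗᵢ[ℂ] K')
    (hf : DenseRange f) (hg : DenseRange g) :
    DenseRange ((tensorIncl H' K').comp (TensorProduct.mapIsometry f g)) := by
  have h : DenseRange (TensorProduct.mapIsometry f g) := by
    intro z
    change z ∈ closure (Set.range _)
    have hr : Set.range (TensorProduct.mapIsometry f g) =
        ((LinearMap.range (TensorProduct.mapIsometry f g).toLinearMap : Submodule ℂ _) :
          Set (H' ⊗[ℂ] K')) := by
      ext; simp
    rw [hr, ← Submodule.topologicalClosure_coe]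
    induction z using TensorProduct.induction_on with
    | zero => exact zero_mem _
    | add x y hx hy => exact add_mem hx hy
    | tmul x y =>
      rw [Submodule.topologicalClosure_coe]
      have hc : Continuous fun p : H' × K' => p.1 ⊗ₜ[ℂ] p.2 := TensorProduct.continuous_tmul
      have hd : DenseRange (Prod.map f g) := hf.prodMap hg
      have := hd.induction_on (p := fun p : H' × K' => p.1 ⊗ₜ[ℂ] p.2 ∈ closure
        ((LinearMap.range (TensorProduct.mapIsometry f g).toLinearMap : Submodule ℂ _) :
          Set (H' ⊗[ℂ] K'))) (x, y) (isClosed_closure.preimage hc) ?_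
      · exact this
      · rintro ⟨a, b⟩
        exact subset_closure ⟨a ⊗ₜ b, by simp⟩
  exact (denseRange_tensorIncl H' K').comp h (tensorIncl H' K').continuous

/-- The associativity unitary `(x ⊗ y) ⊗ z ↦ x ⊗ (y ⊗ z)`. -/
def assocOp : HilbertTensor (HilbertTensor H K) L ≃ₗᵢ[ℂ] HilbertTensor H (HilbertTensor K L) :=
  (TensorProduct.assoc ℂ H K L).extendOfIsometry
    (tripleLeft H K L).toLinearMap (tripleRight H K L).toLinearMap
    (denseRange_map (tensorIncl H K) LinearIsometry.id
      (denseRange_tensorIncl H K) Function.surjective_id.denseRange)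
    (denseRange_map LinearIsometry.id (tensorIncl K L)
      Function.surjective_id.denseRange (denseRange_tensorIncl K L))
    (fun x => by
      change ‖tripleRight H K L (TensorProduct.assoc ℂ H K L x)‖ = ‖tripleLeft H K L x‖
      rw [LinearIsometry.norm_map, LinearIsometry.norm_map]
      exact (TensorProduct.assocIsometry ℂ H K L).norm_map x)

theorem assocOp_tmul (x : H) (y : K) (z : L) :
    assocOp H K L (tensorIncl _ _ (tensorIncl H K (x ⊗ₜ y) ⊗ₜ z)) =
      tensorIncl _ _ (x ⊗ₜ tensorIncl K L (y ⊗ₜ z)) :=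
  LinearEquiv.extendOfIsometry_eq _ _ _ _ _ _ ((x ⊗ₜ y) ⊗ₜ z)

end HilbertTensor

/-! ### Multiplicative unitaries and Kac systems in the sense of Baaj and Skandalis -/

section MultiplicativeUnitary

variable {H : Type*} [NormedAddCommGroup H] [InnerProductSpace ℂ H]

/-- `V₁₂ = V ⊗ 1`. -/
def leg12 (V : HilbertTensor H H →L[ℂ] HilbertTensor H H) :
    HilbertTensor (HilbertTensor H H) H →L[ℂ] HilbertTensor (HilbertTensor H H) H :=
  tensorOp V (ContinuousLinearMap.id ℂ H)

/-- `V₂₃ = 1 ⊗ V`. -/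
def leg23 (V : HilbertTensor H H →L[ℂ] HilbertTensor H H) :
    HilbertTensor (HilbertTensor H H) H →L[ℂ] HilbertTensor (HilbertTensor H H) H :=
  ((assocOp H H H).symm.toContinuousLinearEquiv : _ →L[ℂ] _) ∘L
    tensorOp (ContinuousLinearMap.id ℂ H) V ∘L
    ((assocOp H H H).toContinuousLinearEquiv : _ →L[ℂ] _)

/-- `V₁₃ = Σ₂₃ V₁₂ Σ₂₃`. -/
def leg13 (V : HilbertTensor H H →L[ℂ] HilbertTensor H H) :
    HilbertTensor (HilbertTensor H H) H →L[ℂ] HilbertTensor (HilbertTensor H H) H :=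
  leg23 (flipOp H H) ∘L leg12 V ∘L leg23 (flipOp H H)

variable [CompleteSpace H]

/-- The bounded sesquilinear form `(η, ξ) ↦ ω ((η ⊗ ·)* T (ξ ⊗ ·))`. -/
def sliceForm (ω : (H →L[ℂ] H) →L[ℂ] ℂ) (T : HilbertTensor H H →L[ℂ] HilbertTensor H H) :
    H →L⋆[ℂ] H →L[ℂ] ℂ :=
  LinearMap.mkContinuous₂
    (LinearMap.mk₂'ₛₗ (starRingEnd ℂ) (RingHom.id ℂ)
      (fun η ξ => ω (ContinuousLinearMap.adjoint (leftTensor H H η) ∘L T ∘L leftTensor H H ξ))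
      (fun a b c => by simp [ContinuousLinearMap.add_comp])
      (fun a b c => by simp [-smul_eq_mul, ContinuousLinearMap.smul_comp, map_smulₛₗ])
      (fun a b c => by simp [ContinuousLinearMap.comp_add])
      (fun a b c => by simp))
    (‖ω‖ * (‖leftTensor H H‖ * ‖T‖ * ‖leftTensor H H‖))
    (fun η ξ => by
      simp only [LinearMap.mk₂'ₛₗ_apply]
      refine (ω.le_opNorm _).trans ?_
      have h1 : ‖ContinuousLinearMap.adjoint (leftTensor H H η) ∘L T ∘L leftTensor H H ξ‖ ≤
          ‖ContinuousLinearMap.adjoint (leftTensor H H η)‖ * (‖T‖ * ‖leftTensor H H ξ‖) :=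
        (ContinuousLinearMap.opNorm_comp_le _ _).trans
          (mul_le_mul_of_nonneg_left (ContinuousLinearMap.opNorm_comp_le _ _) (norm_nonneg _))
      rw [LinearIsometryEquiv.norm_map] at h1
      have h2 := (leftTensor H H).le_opNorm η
      have h3 := (leftTensor H H).le_opNorm ξ
      calc _ ≤ ‖ω‖ * ((‖leftTensor H H‖ * ‖η‖) * (‖T‖ * (‖leftTensor H H‖ * ‖ξ‖))) := by
            refine mul_le_mul_of_nonneg_left (h1.trans ?_) (norm_nonneg _)
            gcongr
        _ = _ := by ring)

/-- The slice `(id ⊗ ω)(T)`, the operator with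
`⟪η, (id ⊗ ω)(T) ξ⟫ = ω ((η ⊗ ·)* T (ξ ⊗ ·))` for all `ξ, η`. -/
def rightSlice (ω : (H →L[ℂ] H) →L[ℂ] ℂ) (T : HilbertTensor H H →L[ℂ] HilbertTensor H H) :
    H →L[ℂ] H :=
  ContinuousLinearMap.adjoint (InnerProductSpace.continuousLinearMapOfBilin (sliceForm ω T))

theorem inner_rightSlice (ω : (H →L[ℂ] H) →L[ℂ] ℂ)
    (T : HilbertTensor H H →L[ℂ] HilbertTensor H H) (ξ η : H) :
    ⟪η, rightSlice ω T ξ⟫_ℂ =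
      ω (ContinuousLinearMap.adjoint (leftTensor H H η) ∘L T ∘L leftTensor H H ξ) := by
  rw [rightSlice, ContinuousLinearMap.adjoint_inner_right,
    InnerProductSpace.continuousLinearMapOfBilin_apply]
  rfl

/-- The functionals in the predual of `B(H)`:
`ω(T) = ∑ₖ ⟪ηₖ, T ξₖ⟫` with `∑ₖ ‖ξₖ‖² < ∞` and `∑ₖ ‖ηₖ‖² < ∞`. -/
def IsNormalFunctional (ω : (H →L[ℂ] H) →L[ℂ] ℂ) : Prop :=
  ∃ ξ η : ℕ → H, (Summable fun k => ‖ξ k‖ ^ 2) ∧ (Summable fun k => ‖η k‖ ^ 2) ∧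
    ∀ T : H →L[ℂ] H, HasSum (fun k => ⟪η k, T (ξ k)⟫_ℂ) (ω T)

/-- A regular multiplicative unitary: a unitary `V` on `H ⊗ H` with the pentagon relation
`V₁₂ V₁₃ V₂₃ = V₂₃ V₁₂`, such that the norm closure of
`{(id ⊗ ω)(Σ V) : ω ∈ B(H)_*}` is the algebra of compact operators. -/
structure IsRegularMultiplicativeUnitary
    (V : HilbertTensor H H →L[ℂ] HilbertTensor H H) : Prop where
  isUnitary : V ∈ unitary (HilbertTensor H H →L[ℂ] HilbertTensor H H)
  pentagon : leg12 V * leg13 V * leg23 V = leg23 V * leg12 V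
  regular : closure {S : H →L[ℂ] H | ∃ ω : (H →L[ℂ] H) →L[ℂ] ℂ,
      IsNormalFunctional ω ∧ S = rightSlice ω (flipOp H H * V)} = {S : H →L[ℂ] H | IsCompactOperator S}

end MultiplicativeUnitary

/-! ### Kac systems -/

section KacSystem

variable {H : Type*} [NormedAddCommGroup H] [InnerProductSpace ℂ H] [CompleteSpace H]

/-- `V̂ = Σ (u ⊗ 1) V (u ⊗ 1) Σ`. -/
def hatOp (u : H →L[ℂ] H) (V : HilbertTensor H H →L[ℂ] HilbertTensor H H) :
    HilbertTensor H H →L[ℂ] HilbertTensor H H :=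
  flipOp H H * tensorOp u 1 * V * tensorOp u 1 * flipOp H H

/-- `Ṽ = (u ⊗ 1) (Σ V Σ) (u ⊗ 1)`. -/
def tildeOp (u : H →L[ℂ] H) (V : HilbertTensor H H →L[ℂ] HilbertTensor H H) :
    HilbertTensor H H →L[ℂ] HilbertTensor H H :=
  tensorOp u 1 * (flipOp H H * V * flipOp H H) * tensorOp u 1

/-- A Kac system `(H, V, u)`: `u` is a unitary with `u² = 1`, the operators `V`,
`V̂ = Σ (u ⊗ 1) V (u ⊗ 1) Σ` and `Ṽ = (u ⊗ u) V̂ (u ⊗ u)` are regular multiplicative unitaries,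
and `(Σ (1 ⊗ u) V)³ = 1`. -/
structure IsKacSystem (V : HilbertTensor H H →L[ℂ] HilbertTensor H H) (u : H →L[ℂ] H) :
    Prop where
  isUnitary : u ∈ unitary (H →L[ℂ] H)
  sq_eq_one : u * u = 1
  regular : IsRegularMultiplicativeUnitary V
  regular_hat : IsRegularMultiplicativeUnitary (hatOp u V)
  regular_tilde : IsRegularMultiplicativeUnitary (tensorOp u u * hatOp u V * tensorOp u u)
  cube_eq_one : (flipOp H H * tensorOp 1 u * V) ^ 3 = 1

end KacSystem

/-! ### `L²(X) ⊗ L²(Y) = L²(X × Y)` -/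

section LpTensor

theorem memLp_two_iff {α : Type*} [MeasurableSpace α] {m : Measure α} {f : α → ℂ}
    (hf : AEStronglyMeasurable f m) : MemLp f 2 m ↔ ∫⁻ x, ‖f x‖ₑ ^ 2 ∂m < ∞ := by
  rw [MemLp, and_iff_right hf,
    eLpNorm_lt_top_iff_lintegral_rpow_enorm_lt_top (by norm_num) (by norm_num)]
  simp

theorem norm_Lp_two_eq {α β : Type*} [MeasurableSpace α] [MeasurableSpace β] {m : Measure α}
    {m' : Measure β} (f : Lp ℂ 2 m) (g : Lp ℂ 2 m')
    (h : ∫⁻ x, ‖f x‖ₑ ^ 2 ∂m = ∫⁻ x, ‖g x‖ₑ ^ 2 ∂m') : ‖f‖ = ‖g‖ := by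
  rw [Lp.norm_def, Lp.norm_def, eLpNorm_eq_lintegral_rpow_enorm_toReal (by norm_num) (by norm_num),
    eLpNorm_eq_lintegral_rpow_enorm_toReal (by norm_num) (by norm_num)]
  simp [h]

theorem memLp_tmul {X Y : Type*} [MeasurableSpace X] [MeasurableSpace Y] {μ : Measure X}
    {ν : Measure Y} [SigmaFinite ν] {f : X → ℂ} {g : Y → ℂ} (hf : MemLp f 2 μ) (hg : MemLp g 2 ν) :
    MemLp (fun p : X × Y => f p.1 * g p.2) 2 (μ.prod ν) := by
  have hm : AEStronglyMeasurable (fun p : X × Y => f p.1 * g p.2) (μ.prod ν) :=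
    hf.1.comp_fst.mul hg.1.comp_snd
  rw [memLp_two_iff hm]
  have h1 := (memLp_two_iff hf.1).1 hf
  have h2 := (memLp_two_iff hg.1).1 hg
  simp only [enorm_mul, mul_pow]
  rw [lintegral_prod_mul (hf.1.enorm.pow_const 2) (hg.1.enorm.pow_const 2)]
  exact ENNReal.mul_lt_top h1 h2

variable {X Y : Type*} [MeasurableSpace X] [MeasurableSpace Y]
  (μ : Measure X) (ν : Measure Y) [SigmaFinite μ] [SigmaFinite ν]

/-- The function `(x, y) ↦ f x * g y` in `L²(X × Y)`. -/
def lpMul (f : Lp ℂ 2 μ) (g : Lp ℂ 2 ν) : Lp ℂ 2 (μ.prod ν) :=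
  (memLp_tmul (Lp.memLp f) (Lp.memLp g)).toLp _

set_option linter.unusedSectionVars false in
variable {μ ν} in
theorem coeFn_lpMul (f : Lp ℂ 2 μ) (g : Lp ℂ 2 ν) :
    lpMul μ ν f g =ᵐ[μ.prod ν] fun p => f p.1 * g p.2 := MemLp.coeFn_toLp _

/-- `lpMul` as a bilinear map. -/
def lpMulₗ : Lp ℂ 2 μ →ₗ[ℂ] Lp ℂ 2 ν →ₗ[ℂ] Lp ℂ 2 (μ.prod ν) :=
  LinearMap.mk₂ ℂ (lpMul μ ν)
    (fun f f' g => by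
      apply Lp.ext
      filter_upwards [coeFn_lpMul (f + f') g, Lp.coeFn_add (lpMul μ ν f g) (lpMul μ ν f' g),
        coeFn_lpMul f g, coeFn_lpMul f' g,
        Measure.quasiMeasurePreserving_fst.ae_eq_comp (Lp.coeFn_add f f')] with p h1 h2 h3 h4 h5
      simp only [Function.comp_apply] at h5
      rw [h1, h5, h2, Pi.add_apply, Pi.add_apply, h3, h4, add_mul])
    (fun c f g => by
      apply Lp.ext
      filter_upwards [coeFn_lpMul (c • f) g, Lp.coeFn_smul c (lpMul μ ν f g), coeFn_lpMul f g,
        Measure.quasiMeasurePreserving_fst.ae_eq_comp (Lp.coeFn_smul c f)] with p h1 h2 h3 h5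
      simp only [Function.comp_apply] at h5
      simp [h1, h2, h3, h5, mul_assoc])
    (fun f g g' => by
      apply Lp.ext
      filter_upwards [coeFn_lpMul f (g + g'), Lp.coeFn_add (lpMul μ ν f g) (lpMul μ ν f g'),
        coeFn_lpMul f g, coeFn_lpMul f g',
        Measure.quasiMeasurePreserving_snd.ae_eq_comp (Lp.coeFn_add g g')] with p h1 h2 h3 h4 h5
      simp only [Function.comp_apply] at h5
      rw [h1, h5, h2, Pi.add_apply, Pi.add_apply, h3, h4, mul_add])
    (fun c f g => by
      apply Lp.ext
      filter_upwards [coeFn_lpMul f (c • g), Lp.coeFn_smul c (lpMul μ ν f g), coeFn_lpMul f g,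
        Measure.quasiMeasurePreserving_snd.ae_eq_comp (Lp.coeFn_smul c g)] with p h1 h2 h3 h5
      simp only [Function.comp_apply] at h5
      simp [h1, h2, h3, h5, mul_left_comm])

theorem inner_lpMul (f f' : Lp ℂ 2 μ) (g g' : Lp ℂ 2 ν) :
    ⟪lpMul μ ν f g, lpMul μ ν f' g'⟫_ℂ = ⟪f, f'⟫_ℂ * ⟪g, g'⟫_ℂ := by
  rw [L2.inner_def, L2.inner_def, L2.inner_def, ← integral_prod_mul]
  apply integral_congr_ae
  filter_upwards [coeFn_lpMul f g, coeFn_lpMul f' g'] with p h1 h2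
  simp only [h1, h2, RCLike.inner_apply, map_mul]
  ring

/-- The isometry `f ⊗ g ↦ ((x, y) ↦ f x * g y)` on the algebraic tensor product. -/
def lpTensorIncl : Lp ℂ 2 μ ⊗[ℂ] Lp ℂ 2 ν →ₗᵢ[ℂ] Lp ℂ 2 (μ.prod ν) where
  toLinearMap := TensorProduct.lift (lpMulₗ μ ν)
  norm_map' := by
    have key : ∀ x y : Lp ℂ 2 μ ⊗[ℂ] Lp ℂ 2 ν,
        ⟪TensorProduct.lift (lpMulₗ μ ν) x, TensorProduct.lift (lpMulₗ μ ν) y⟫_ℂ = ⟪x, y⟫_ℂ := by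
      intro x y
      induction x using TensorProduct.induction_on with
      | zero => simp
      | add x x' hx hx' => simp only [map_add, inner_add_left, hx, hx']
      | tmul f g =>
        induction y using TensorProduct.induction_on with
        | zero => simp
        | add x x' hx hx' => simp only [map_add, inner_add_right, hx, hx']
        | tmul f' g' =>
          rw [TensorProduct.lift.tmul, TensorProduct.lift.tmul, TensorProduct.inner_tmul]
          exact inner_lpMul μ ν f f' g g'
    intro x
    rw [@norm_eq_sqrt_re_inner ℂ, @norm_eq_sqrt_re_inner ℂ _ _ _ _ x, key]

theorem denseRange_lpTensorIncl : DenseRange (lpTensorIncl μ ν) := by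
  set K : Submodule ℂ (Lp ℂ 2 (μ.prod ν)) := LinearMap.range (lpTensorIncl μ ν).toLinearMap
    with hK
  have hr : Set.range (lpTensorIncl μ ν) = (K : Set (Lp ℂ 2 (μ.prod ν))) := by
    ext; simp [hK]
  have hd : Dense (K : Set (Lp ℂ 2 (μ.prod ν))) := by
    rw [Submodule.dense_iff_topologicalClosure_eq_top,
      Submodule.topologicalClosure_eq_top_iff, Submodule.eq_bot_iff]
    intro f hf
    -- `f` integrates to zero over every rectangle of finite measure
    have hrect : ∀ (A : Set X) (B : Set Y), MeasurableSet A → MeasurableSet B → μ A ≠ ∞ →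
        ν B ≠ ∞ → ∫ p in A ×ˢ B, f p ∂(μ.prod ν) = 0 := by
      intro A B hA hB hμA hνB
      have h0 := (Submodule.mem_orthogonal K f).1 hf
        (lpTensorIncl μ ν (indicatorConstLp 2 hA hμA 1 ⊗ₜ indicatorConstLp 2 hB hνB 1))
        ⟨_, rfl⟩
      rw [L2.inner_def] at h0
      rw [← integral_indicator (hA.prod hB), ← h0]
      apply integral_congr_ae
      have hc : lpTensorIncl μ ν (indicatorConstLp 2 hA hμA 1 ⊗ₜ indicatorConstLp 2 hB hνB 1) =
        lpMul μ ν (indicatorConstLp 2 hA hμA 1) (indicatorConstLp 2 hB hνB 1) := rfl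
      rw [hc]
      filter_upwards [coeFn_lpMul (indicatorConstLp 2 hA hμA (1 : ℂ))
        (indicatorConstLp 2 hB hνB (1 : ℂ)),
        Measure.quasiMeasurePreserving_fst.ae_eq_comp
          (indicatorConstLp_coeFn (p := 2) (hs := hA) (hμs := hμA) (c := (1 : ℂ))),
        Measure.quasiMeasurePreserving_snd.ae_eq_comp
          (indicatorConstLp_coeFn (p := 2) (hs := hB) (hμs := hνB) (c := (1 : ℂ)))]
        with p h1 h2 h3
      simp only [Function.comp_apply] at h2 h3
      rw [h1, h2, h3]
      by_cases ha : p.1 ∈ A <;> by_cases hb : p.2 ∈ B <;> simp [ha, hb, Set.indicator]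
    have hzero : ∀ n, ∀ᵐ p ∂(μ.prod ν), p ∈ spanningSets μ n ×ˢ spanningSets ν n → f p = 0 := by
      intro n
      set R := spanningSets μ n ×ˢ spanningSets ν n with hR
      have hRm : MeasurableSet R :=
        (measurableSet_spanningSets μ n).prod (measurableSet_spanningSets ν n)
      have hRfin : (μ.prod ν) R < ∞ := by
        rw [hR, Measure.prod_prod]
        exact ENNReal.mul_lt_top (measure_spanningSets_lt_top μ n)
          (measure_spanningSets_lt_top ν n)
      have : IsFiniteMeasure ((μ.prod ν).restrict R) := ⟨by simpa using hRfin⟩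
      have hint : Integrable f ((μ.prod ν).restrict R) :=
        ((Lp.memLp f).restrict R).integrable (by norm_num)
      have hset : ∀ s, MeasurableSet s → ∫ p in s, f p ∂((μ.prod ν).restrict R) = 0 := by
        have huniv : ∫ p, f p ∂((μ.prod ν).restrict R) = 0 :=
          hrect _ _ (measurableSet_spanningSets μ n) (measurableSet_spanningSets ν n)
            (measure_spanningSets_lt_top μ n).ne (measure_spanningSets_lt_top ν n).ne
        intro s hs
        induction s, hs using MeasurableSpace.induction_on_inter generateFrom_prod.symm
          isPiSystem_prod with
        | empty => simp
        | basic t ht =>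
          obtain ⟨A, hA, B, hB, rfl⟩ := ht
          have hA' : MeasurableSet A := hA
          have hB' : MeasurableSet B := hB
          rw [Measure.restrict_restrict (hA'.prod hB'), hR, Set.prod_inter_prod]
          exact hrect _ _ (hA'.inter (measurableSet_spanningSets μ n))
            (hB'.inter (measurableSet_spanningSets ν n))
            (measure_ne_top_of_subset Set.inter_subset_right
              (measure_spanningSets_lt_top μ n).ne)
            (measure_ne_top_of_subset Set.inter_subset_right
              (measure_spanningSets_lt_top ν n).ne)
        | compl t ht ih =>
          have := integral_add_compl ht hint
          rw [ih, huniv, zero_add] at this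
          exact this
        | iUnion g hdisj hm ih =>
          rw [integral_iUnion hm hdisj hint.integrableOn]
          simp [ih]
      have := hint.ae_eq_zero_of_forall_setIntegral_eq_zero (fun s hs _ => hset s hs)
      exact (ae_restrict_iff' hRm).1 this
    rw [Lp.eq_zero_iff_ae_eq_zero]
    filter_upwards [ae_all_iff.2 hzero] with p hp
    have h1 := mem_spanningSetsIndex μ p.1
    have h2 := mem_spanningSetsIndex ν p.2
    refine hp (max (spanningSetsIndex μ p.1) (spanningSetsIndex ν p.2)) ⟨?_, ?_⟩
    · exact monotone_spanningSets μ (le_max_left _ _) h1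
    · exact monotone_spanningSets ν (le_max_right _ _) h2
  change Dense (Set.range _)
  rw [hr]
  exact hd

/-- The canonical unitary `L²(X) ⊗ L²(Y) ≃ L²(X × Y)`, `f ⊗ g ↦ ((x, y) ↦ f x * g y)`. -/
def lpTensorEquiv :
    HilbertTensor (Lp ℂ 2 μ) (Lp ℂ 2 ν) ≃ₗᵢ[ℂ] Lp ℂ 2 (μ.prod ν) :=
  (LinearEquiv.refl ℂ (Lp ℂ 2 μ ⊗[ℂ] Lp ℂ 2 ν)).extendOfIsometry
    (tensorIncl _ _).toLinearMap (lpTensorIncl μ ν).toLinearMap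
    (denseRange_tensorIncl _ _) (denseRange_lpTensorIncl μ ν)
    (fun x => ((lpTensorIncl μ ν).norm_map x).trans ((tensorIncl _ _).norm_map x).symm)

theorem lpTensorEquiv_tmul (f : Lp ℂ 2 μ) (g : Lp ℂ 2 ν) :
    lpTensorEquiv μ ν (tensorIncl _ _ (f ⊗ₜ g)) = lpMul μ ν f g :=
  LinearEquiv.extendOfIsometry_eq _ _ _ _ _ _ (f ⊗ₜ g)

end LpTensor

/-! ### Weighted composition operators on `L²` -/

section WeightedComposition

variable {X : Type*} [MeasurableSpace X] {μ : Measure X}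

/-- The condition on `φ : X → X` and on a nowhere vanishing weight `w : X → ℂ` under which
`f ↦ w · (f ∘ φ)` is an isometry of `L²(μ)`. -/
structure IsIsometricWeight (μ : Measure X) (φ : X → X) (w : X → ℂ) : Prop where
  measurable_map : Measurable φ
  measurable_weight : Measurable w
  weight_ne_zero : ∀ x, w x ≠ 0
  lintegral_eq : ∀ f : X → ℝ≥0∞, Measurable f → ∫⁻ x, ‖w x‖ₑ ^ 2 * f (φ x) ∂μ = ∫⁻ x, f x ∂μ

namespace IsIsometricWeight

variable {φ : X → X} {w : X → ℂ}

theorem quasiMeasurePreserving (h : IsIsometricWeight μ φ w) :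
    Measure.QuasiMeasurePreserving φ μ μ := by
  refine ⟨h.measurable_map, Measure.AbsolutelyContinuous.mk fun s hs h0 => ?_⟩
  rw [Measure.map_apply h.measurable_map hs]
  have h1 := h.lintegral_eq (s.indicator 1) (measurable_one.indicator hs)
  have hm : Measurable fun x => ‖w x‖ₑ ^ 2 * s.indicator (1 : X → ℝ≥0∞) (φ x) :=
    (h.measurable_weight.enorm.pow_const 2).mul
      ((measurable_one.indicator hs).comp h.measurable_map)
  rw [lintegral_indicator_one hs, h0, lintegral_eq_zero_iff hm] at h1
  rw [measure_eq_zero_iff_ae_notMem]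
  filter_upwards [h1] with x hx hxs
  have hxs' : φ x ∈ s := hxs
  simp [hxs', h.weight_ne_zero x] at hx

theorem memLp (h : IsIsometricWeight μ φ w) (f : Lp ℂ 2 μ) :
    MemLp (fun x => w x * f (φ x)) 2 μ ∧
      ∫⁻ x, ‖w x * f (φ x)‖ₑ ^ 2 ∂μ = ∫⁻ x, ‖f x‖ₑ ^ 2 ∂μ := by
  have hm : AEStronglyMeasurable (fun x => w x * f (φ x)) μ :=
    h.measurable_weight.aestronglyMeasurable.mul
      ((Lp.aestronglyMeasurable f).comp_quasiMeasurePreserving h.quasiMeasurePreserving)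
  have he : ∫⁻ x, ‖w x * f (φ x)‖ₑ ^ 2 ∂μ = ∫⁻ x, ‖f x‖ₑ ^ 2 ∂μ := by
    simp only [enorm_mul, mul_pow]
    exact h.lintegral_eq (fun x => ‖f x‖ₑ ^ 2)
      ((Lp.stronglyMeasurable f).measurable.enorm.pow_const 2)
  refine ⟨(memLp_two_iff hm).2 ?_, he⟩
  rw [he]
  exact (memLp_two_iff (Lp.aestronglyMeasurable f)).1 (Lp.memLp f)

/-- The isometry `f ↦ w · (f ∘ φ)` of `L²(μ)`. -/
def toIsometry (h : IsIsometricWeight μ φ w) : Lp ℂ 2 μ →ₗᵢ[ℂ] Lp ℂ 2 μ where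
  toFun f := (h.memLp f).1.toLp _
  map_add' f g := by
    apply Lp.ext
    filter_upwards [(h.memLp (f + g)).1.coeFn_toLp, (h.memLp f).1.coeFn_toLp,
      (h.memLp g).1.coeFn_toLp, Lp.coeFn_add ((h.memLp f).1.toLp _) ((h.memLp g).1.toLp _),
      h.quasiMeasurePreserving.ae_eq_comp (Lp.coeFn_add f g)] with x h1 h2 h3 h4 h5
    simp only [Function.comp_apply] at h5
    rw [h1, h4, Pi.add_apply, h2, h3, h5, Pi.add_apply, mul_add]
  map_smul' c f := by
    apply Lp.ext
    filter_upwards [(h.memLp (c • f)).1.coeFn_toLp, (h.memLp f).1.coeFn_toLp,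
      Lp.coeFn_smul c ((h.memLp f).1.toLp _),
      h.quasiMeasurePreserving.ae_eq_comp (Lp.coeFn_smul c f)] with x h1 h2 h4 h5
    simp only [Function.comp_apply] at h5
    rw [h1, RingHom.id_apply, h4, Pi.smul_apply, h2, h5, Pi.smul_apply, smul_eq_mul, smul_eq_mul,
      mul_left_comm]
  norm_map' f := by
    refine norm_Lp_two_eq _ _ (Eq.trans (lintegral_congr_ae ?_) (h.memLp f).2)
    filter_upwards [(h.memLp f).1.coeFn_toLp] with x h1
    exact congrArg (fun z : ℂ => ‖z‖ₑ ^ 2) h1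

theorem coeFn_toIsometry (h : IsIsometricWeight μ φ w) (f : Lp ℂ 2 μ) :
    h.toIsometry f =ᵐ[μ] fun x => w x * f (φ x) := (h.memLp f).1.coeFn_toLp

end IsIsometricWeight

/-- Complex conjugation on `L²(μ)`. -/
def lpConj (μ : Measure X) : Lp ℂ 2 μ →ₗᵢ⋆[ℂ] Lp ℂ 2 μ where
  toFun f := star f
  map_add' f g := by
    apply Lp.ext
    filter_upwards [Lp.coeFn_star (f + g), Lp.coeFn_add f g, Lp.coeFn_star f, Lp.coeFn_star g,
      Lp.coeFn_add (star f) (star g)] with x h1 h2 h3 h4 h5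
    rw [h1, h5, Pi.add_apply, h3, h4, Pi.star_apply, h2, Pi.add_apply, star_add]
    rfl
  map_smul' c f := by
    apply Lp.ext
    filter_upwards [Lp.coeFn_star (c • f), Lp.coeFn_smul c f, Lp.coeFn_star f,
      Lp.coeFn_smul (conj c) (star f)] with x h1 h2 h3 h5
    rw [h1, h5, Pi.smul_apply, h3, Pi.star_apply, h2, Pi.smul_apply, smul_eq_mul, smul_eq_mul,
      star_mul']
    rfl
  norm_map' f := by
    refine norm_Lp_two_eq _ _ (lintegral_congr_ae ?_)
    filter_upwards [Lp.coeFn_star f] with x h1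
    have h2 : ((star f : Lp ℂ 2 μ) : X → ℂ) x = star (f x) := h1
    change ‖((star f : Lp ℂ 2 μ) : X → ℂ) x‖ₑ ^ 2 = ‖f x‖ₑ ^ 2
    rw [h2, ← ofReal_norm, norm_star, ofReal_norm]

theorem coeFn_lpConj (f : Lp ℂ 2 μ) : lpConj μ f =ᵐ[μ] fun x => conj (f x) := Lp.coeFn_star f

end WeightedComposition

/-! ### The Hilbert space and the operators of the quantum Heisenberg group -/

section QuantumHeisenberg

/-- The space of the variables `(x, y, r)`, `x, y ∈ ℝⁿ`, `r ∈ ℝ`, written `((x, y), r)`. -/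
abbrev HeisVar (n : ℕ) : Type :=
  (EuclideanSpace ℝ (Fin n) × EuclideanSpace ℝ (Fin n)) × ℝ

/-- `ℋ = L²` of the variables `(x, y, r)` with respect to Lebesgue measure. -/
abbrev HeisSpace (n : ℕ) : Type := Lp ℂ 2 (volume : Measure (HeisVar n))

/-- `L²` of the variables `(x, y, r, x', y', r')` with respect to Lebesgue measure. -/
abbrev HeisSpaceProd (n : ℕ) : Type :=
  Lp ℂ 2 ((volume : Measure (HeisVar n)).prod (volume : Measure (HeisVar n)))

/-- `η_λ(r) = (e^{2λr} - 1) / (2λ)`, and `η_0(r) = r`. -/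
def heisEta (lam r : ℝ) : ℝ :=
  if lam = 0 then r else (Real.exp (2 * lam * r) - 1) / (2 * lam)

/-- `ē(t) = e^{-2πit}`. -/
def eBar (t : ℝ) : ℂ := Complex.exp (-(2 * Real.pi * t * Complex.I))

theorem enorm_eBar (t : ℝ) : ‖eBar t‖ₑ = 1 := by
  have : ‖eBar t‖ = 1 := by
    rw [eBar, Complex.norm_exp]
    simp
  rw [← ofReal_norm, this, ENNReal.ofReal_one]

theorem eBar_ne_zero (t : ℝ) : eBar t ≠ 0 := Complex.exp_ne_zero _

@[fun_prop]
theorem measurable_eBar : Measurable eBar := by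
  unfold eBar
  fun_prop

@[fun_prop]
theorem measurable_heisEta (lam : ℝ) : Measurable (heisEta lam) := by
  unfold heisEta
  split_ifs <;> fun_prop

variable (n : ℕ) (lam : ℝ)

variable {n} in
/-- `β(x, y)`, the usual inner product on `ℝⁿ`. -/
def heisBeta (x y : EuclideanSpace ℝ (Fin n)) : ℝ := ⟪x, y⟫_ℝ

variable {n} in
@[fun_prop]
theorem measurable_heisBeta {α : Type*} [MeasurableSpace α] {f g : α → EuclideanSpace ℝ (Fin n)}
    (hf : Measurable f) (hg : Measurable g) : Measurable fun a => heisBeta (f a) (g a) :=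
  hf.inner hg

theorem isAddHaarMeasure_prod :
    (volume : Measure (EuclideanSpace ℝ (Fin n) × EuclideanSpace ℝ (Fin n))).IsAddHaarMeasure :=
  Measure.prod.instIsAddHaarMeasure _ _

theorem isAddHaarMeasure_heisVar : (volume : Measure (HeisVar n)).IsAddHaarMeasure :=
  have := isAddHaarMeasure_prod n
  Measure.prod.instIsAddHaarMeasure _ _

/-- Change of variables `(v, r) ↦ (c(r) v, σ(r))`. -/
theorem lintegral_dilation {c : ℝ → ℝ} (hc : Measurable c) (hc0 : ∀ r, c r ≠ 0) {σ : ℝ → ℝ}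
    (hσ : MeasurePreserving σ volume volume) (f : HeisVar n → ℝ≥0∞) (hf : Measurable f) :
    ∫⁻ p : HeisVar n, ENNReal.ofReal |c p.2 ^ n| ^ 2 * f (c p.2 • p.1, σ p.2) = ∫⁻ p, f p := by
  have hσm := hσ.measurable
  have hsm : Measurable fun p : HeisVar n => f (c p.2 • p.1, σ p.2) := by fun_prop
  rw [Measure.volume_eq_prod, lintegral_prod_symm _ (by fun_prop),
    lintegral_prod_symm _ hf.aemeasurable]
  have key : ∀ r : ℝ, ∫⁻ v : EuclideanSpace ℝ (Fin n) × EuclideanSpace ℝ (Fin n),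
      ENNReal.ofReal |c r ^ n| ^ 2 * f (c r • v, σ r) = ∫⁻ v, f (v, σ r) := by
    intro r
    rw [lintegral_const_mul _ (by fun_prop)]
    have := isAddHaarMeasure_prod n
    have hmap := Measure.map_addHaar_smul
      (volume : Measure (EuclideanSpace ℝ (Fin n) × EuclideanSpace ℝ (Fin n))) (hc0 r)
    have h1 : ∫⁻ v : EuclideanSpace ℝ (Fin n) × EuclideanSpace ℝ (Fin n), f (c r • v, σ r) =
        ∫⁻ v, f (v, σ r) ∂(Measure.map (c r • ·)
          (volume : Measure (EuclideanSpace ℝ (Fin n) × EuclideanSpace ℝ (Fin n)))) := by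
      rw [lintegral_map (by fun_prop) (by fun_prop)]
    rw [h1, hmap, lintegral_smul_measure, smul_eq_mul, ← mul_assoc]
    have h2 : ENNReal.ofReal |c r ^ n| ^ 2 * ENNReal.ofReal |(c r ^ Module.finrank ℝ
        (EuclideanSpace ℝ (Fin n) × EuclideanSpace ℝ (Fin n)))⁻¹| = 1 := by
      rw [← ENNReal.ofReal_pow (abs_nonneg _), ← ENNReal.ofReal_mul (by positivity),
        Module.finrank_prod, finrank_euclideanSpace, Fintype.card_fin, ← abs_pow, ← abs_mul]
      have : c r ≠ 0 := hc0 r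
      rw [← pow_mul, mul_two, mul_inv_cancel₀ (pow_ne_zero _ this)]
      simp
    rw [h2, one_mul]
  simp only [key]
  exact hσ.lintegral_comp (f := fun r => ∫⁻ v, f (v, r)) (by fun_prop)

theorem isIsometricWeight_of_dilation {c : ℝ → ℝ} (hc : Measurable c) (hc0 : ∀ r, c r ≠ 0)
    {σ : ℝ → ℝ} (hσ : MeasurePreserving σ volume volume) {w : HeisVar n → ℂ} (hw : Measurable w)
    (hwc : ∀ p, ‖w p‖ₑ = ENNReal.ofReal |c p.2 ^ n|) :
    IsIsometricWeight (volume : Measure (HeisVar n)) (fun p => (c p.2 • p.1, σ p.2)) w where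
  measurable_map := by
    have := hσ.measurable
    fun_prop
  measurable_weight := hw
  weight_ne_zero p := by
    rw [← enorm_ne_zero, hwc]
    simp [hc0 p.2]
  lintegral_eq f hf := by
    simp only [hwc]
    exact lintegral_dilation n hc hc0 hσ f hf

theorem enorm_exp_pow (t : ℝ) : ‖((Real.exp t ^ n : ℝ) : ℂ)‖ₑ =
    ENNReal.ofReal |Real.exp t ^ n| := by
  rw [← ofReal_norm, Complex.norm_real, Real.norm_eq_abs]

variable {n} in
/-- The point map in the definition of `j`. -/
def heisjMap (p : HeisVar n) : HeisVar n := (-(Real.exp (lam * p.2)) • p.1, -p.2)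

variable {n} in
/-- The weight in the definition of `j`. -/
def heisjWeight (p : HeisVar n) : ℂ :=
  (Real.exp (lam * p.2) ^ n : ℝ) * eBar (heisEta lam p.2 * heisBeta p.1.1 p.1.2)

theorem isIsometricWeight_heisj :
    IsIsometricWeight (volume : Measure (HeisVar n)) (heisjMap lam) (heisjWeight lam) :=
  isIsometricWeight_of_dilation n (c := fun r => -Real.exp (lam * r)) (by fun_prop)
    (fun r => neg_ne_zero.2 (Real.exp_ne_zero _)) (Measure.measurePreserving_neg volume)
    (by unfold heisjWeight; fun_prop)
    (fun p => by
      rw [heisjWeight, enorm_mul, enorm_eBar, mul_one, enorm_exp_pow, neg_pow, abs_mul]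
      simp)

/-- The operator
`(j ξ)(x, y, r) = (e^{λr})ⁿ ē(η_λ(r) β(x, y)) ξ(-e^{λr} x, -e^{λr} y, -r)`. -/
def heisj : HeisSpace n →L[ℂ] HeisSpace n :=
  (isIsometricWeight_heisj n lam).toIsometry.toContinuousLinearMap

theorem heisj_apply (ξ : HeisSpace n) :
    heisj n lam ξ =ᵐ[volume] fun p => (Real.exp (lam * p.2) ^ n : ℝ) *
      eBar (heisEta lam p.2 * heisBeta p.1.1 p.1.2) *
        ξ ((-Real.exp (lam * p.2) • p.1.1, -Real.exp (lam * p.2) • p.1.2), -p.2) :=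
  (isIsometricWeight_heisj n lam).coeFn_toIsometry ξ

variable {n} in
/-- The point map in the definition of `J`. -/
def heisJMap (p : HeisVar n) : HeisVar n := ((-1 : ℝ) • p.1, p.2)

variable {n} in
/-- The weight in the definition of `J`. -/
def heisJWeight (p : HeisVar n) : ℂ := eBar (heisEta lam p.2 * heisBeta p.1.1 p.1.2)

theorem isIsometricWeight_heisJ :
    IsIsometricWeight (volume : Measure (HeisVar n)) heisJMap (heisJWeight lam) :=
  isIsometricWeight_of_dilation n (c := fun _ => -1) (by fun_prop) (fun _ => by norm_num)
    (MeasurePreserving.id volume) (by unfold heisJWeight; fun_prop)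
    (fun p => by simp [heisJWeight, enorm_eBar])

/-- The antiunitary `(J ξ)(x, y, r) = ē(η_λ(r) β(x, y)) conj (ξ(-x, -y, r))`. -/
def heisJ : HeisSpace n →ₗᵢ⋆[ℂ] HeisSpace n :=
  (isIsometricWeight_heisJ n lam).toIsometry.comp (lpConj volume)

theorem heisJ_apply (ξ : HeisSpace n) :
    heisJ n lam ξ =ᵐ[volume] fun p =>
      eBar (heisEta lam p.2 * heisBeta p.1.1 p.1.2) * conj (ξ ((-p.1.1, -p.1.2), p.2)) := by
  filter_upwards [(isIsometricWeight_heisJ n lam).coeFn_toIsometry (lpConj volume ξ),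
    (isIsometricWeight_heisJ n lam).quasiMeasurePreserving.ae_eq_comp (coeFn_lpConj ξ)] with p h1 h2
  simp only [Function.comp_apply] at h2
  refine h1.trans ?_
  rw [h2]
  have h3 : heisJMap p = ((-p.1.1, -p.1.2), p.2) := by
    unfold heisJMap
    rw [neg_one_smul]
    rfl
  rw [h3]
  rfl

variable {n} in
/-- The point map in the definition of `Ĵ`. -/
def heisJhatMap (p : HeisVar n) : HeisVar n := (Real.exp (lam * p.2) • p.1, -p.2)

variable {n} in
/-- The weight in the definition of `Ĵ`. -/
def heisJhatWeight (p : HeisVar n) : ℂ := (Real.exp (lam * p.2) ^ n : ℝ)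

theorem isIsometricWeight_heisJhat :
    IsIsometricWeight (volume : Measure (HeisVar n)) (heisJhatMap lam) (heisJhatWeight lam) :=
  isIsometricWeight_of_dilation n (c := fun r => Real.exp (lam * r)) (by fun_prop)
    (fun r => Real.exp_ne_zero _) (Measure.measurePreserving_neg volume)
    (by unfold heisJhatWeight; fun_prop)
    (fun p => by rw [heisJhatWeight, enorm_exp_pow])

/-- The antiunitary `(Ĵ ξ)(x, y, r) = (e^{λr})ⁿ conj (ξ(e^{λr} x, e^{λr} y, -r))`. -/
def heisJhat : HeisSpace n →ₗᵢ⋆[ℂ] HeisSpace n :=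
  (isIsometricWeight_heisJhat n lam).toIsometry.comp (lpConj volume)

theorem heisJhat_apply (ξ : HeisSpace n) :
    heisJhat n lam ξ =ᵐ[volume] fun p => (Real.exp (lam * p.2) ^ n : ℝ) *
      conj (ξ ((Real.exp (lam * p.2) • p.1.1, Real.exp (lam * p.2) • p.1.2), -p.2)) := by
  filter_upwards [(isIsometricWeight_heisJhat n lam).coeFn_toIsometry (lpConj volume ξ),
    (isIsometricWeight_heisJhat n lam).quasiMeasurePreserving.ae_eq_comp (coeFn_lpConj ξ)]
    with p h1 h2
  simp only [Function.comp_apply] at h2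
  refine h1.trans ?_
  rw [h2]
  rfl

variable {n} in
/-- The point map in the definition of `U_A`. -/
def heisUMap (q : HeisVar n × HeisVar n) : HeisVar n × HeisVar n :=
  ((Real.exp (-(lam * q.2.2)) • q.1.1, q.1.2 + q.2.2),
    (q.2.1 - Real.exp (-(lam * q.2.2)) • q.1.1, q.2.2))

variable {n} in
/-- The weight in the definition of `U_A`. -/
def heisUWeight (q : HeisVar n × HeisVar n) : ℂ :=
  (Real.exp (-(lam * q.2.2)) ^ n : ℝ) *
    eBar (heisEta lam q.2.2 * heisBeta (Real.exp (-(lam * q.2.2)) • q.1.1.1)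
      (q.2.1.2 - Real.exp (-(lam * q.2.2)) • q.1.1.2))

theorem isIsometricWeight_heisU :
    IsIsometricWeight ((volume : Measure (HeisVar n)).prod (volume : Measure (HeisVar n)))
      (heisUMap lam) (heisUWeight lam) where
  measurable_map := by unfold heisUMap; fun_prop
  measurable_weight := by unfold heisUWeight; fun_prop
  weight_ne_zero q := mul_ne_zero (by simp) (eBar_ne_zero _)
  lintegral_eq f hf := by
    have hw : ∀ q : HeisVar n × HeisVar n, ‖heisUWeight lam q‖ₑ =
        ENNReal.ofReal |Real.exp (-(lam * q.2.2)) ^ n| := fun q => by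
      rw [heisUWeight, enorm_mul, enorm_eBar, mul_one, enorm_exp_pow]
    simp only [hw, heisUMap]
    rw [lintegral_prod_symm _ (by fun_prop)]
    have key : ∀ q : HeisVar n, ∫⁻ p : HeisVar n,
        ENNReal.ofReal |Real.exp (-(lam * q.2)) ^ n| ^ 2 *
          f ((Real.exp (-(lam * q.2)) • p.1, p.2 + q.2),
            (q.1 - Real.exp (-(lam * q.2)) • p.1, q.2)) =
        ∫⁻ p : HeisVar n, f (p, q - (p.1, 0)) := by
      intro q
      have := lintegral_dilation n (c := fun _ => Real.exp (-(lam * q.2))) (by fun_prop)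
        (fun _ => Real.exp_ne_zero _) (measurePreserving_add_right volume q.2)
        (fun p => f (p, q - (p.1, 0))) (by fun_prop)
      have hq : ∀ p : HeisVar n, q - (Real.exp (-(lam * q.2)) • p.1, 0) =
          (q.1 - Real.exp (-(lam * q.2)) • p.1, q.2) := fun p => by
        ext <;> simp
      rw [← this]
      simp only [hq]
    simp only [key]
    rw [lintegral_lintegral_swap (by fun_prop)]
    have := isAddHaarMeasure_heisVar n
    have key2 : ∀ p : HeisVar n, ∫⁻ q : HeisVar n, f (p, q - (p.1, 0)) =
        ∫⁻ q : HeisVar n, f (p, q) := fun p =>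
      lintegral_sub_right_eq_self (fun q => f (p, q)) (p.1, 0)
    simp only [key2]
    rw [lintegral_prod _ hf.aemeasurable]

/-- The operator on `L²` of the variables `(x, y, r, x', y', r')` given by
`(U ξ)(x, y, r, x', y', r') = (e^{-λr'})ⁿ ē(η_λ(r') β(e^{-λr'} x, y' - e^{-λr'} y))
  ξ(e^{-λr'} x, e^{-λr'} y, r + r', x' - e^{-λr'} x, y' - e^{-λr'} y, r')`. -/
def heisULp : HeisSpaceProd n →L[ℂ] HeisSpaceProd n :=
  (isIsometricWeight_heisU n lam).toIsometry.toContinuousLinearMap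

theorem heisULp_apply (ξ : HeisSpaceProd n) :
    heisULp n lam ξ =ᵐ[(volume : Measure (HeisVar n)).prod volume] fun q => (Real.exp (-(lam * q.2.2)) ^ n : ℝ) *
      eBar (heisEta lam q.2.2 * heisBeta (Real.exp (-(lam * q.2.2)) • q.1.1.1)
        (q.2.1.2 - Real.exp (-(lam * q.2.2)) • q.1.1.2)) *
      ξ (((Real.exp (-(lam * q.2.2)) • q.1.1.1, Real.exp (-(lam * q.2.2)) • q.1.1.2),
          q.1.2 + q.2.2),
        ((q.2.1.1 - Real.exp (-(lam * q.2.2)) • q.1.1.1,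
          q.2.1.2 - Real.exp (-(lam * q.2.2)) • q.1.1.2), q.2.2)) :=
  (isIsometricWeight_heisU n lam).coeFn_toIsometry ξ

/-- The operator `U_A` on `ℋ ⊗ ℋ`, with `ℋ ⊗ ℋ` identified with `L²` of the variables
`(x, y, r, x', y', r')`. -/
def heisU : HilbertTensor (HeisSpace n) (HeisSpace n) →L[ℂ]
    HilbertTensor (HeisSpace n) (HeisSpace n) :=
  ((lpTensorEquiv (volume : Measure (HeisVar n)) (volume : Measure (HeisVar n))).symm :
      HeisSpaceProd n ≃L[ℂ] HilbertTensor (HeisSpace n) (HeisSpace n)).toContinuousLinearMap ∘L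
    heisULp n lam ∘L
    ((lpTensorEquiv (volume : Measure (HeisVar n)) (volume : Measure (HeisVar n))) :
      HilbertTensor (HeisSpace n) (HeisSpace n) ≃L[ℂ] HeisSpaceProd n).toContinuousLinearMap

end QuantumHeisenberg

end

/-! ### Operators on Hilbert space tensor products -/

section TensorAlgebra

variable {H K L H' K' H'' K'' : Type*} [NormedAddCommGroup H] [InnerProductSpace ℂ H]
  [NormedAddCommGroup K] [InnerProductSpace ℂ K] [NormedAddCommGroup L] [InnerProductSpace ℂ L]
  [NormedAddCommGroup H'] [InnerProductSpace ℂ H'] [NormedAddCommGroup K'] [InnerProductSpace ℂ K']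
  [NormedAddCommGroup H''] [InnerProductSpace ℂ H'']
  [NormedAddCommGroup K''] [InnerProductSpace ℂ K'']

/-! On `L²`, the operators `U_A`, `j`, `Σ` and everything built from them by products and legs have
the form `f ↦ w · (f ∘ φ)` (`ActsAs`). Such operators compose by composing the point maps and
multiplying the weights, so an operator identity follows from a pointwise identity of point maps and
weights (`ActsAs.eq`, `ActsAs.eq_one`). Every weight here is a dilation factor times a phase `ē(t)`,
which leaves real algebra whose only non-formal input is the cocycle identity `η(r + s) = η(r) +
e^{2λr} η(s)` (`heisEta_add`). This gives `j² = 1`, the pentagon relations for `U_A` and `Û_A`, and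
`(Σ(1 ⊗ j)U_A)³ = 1`.

The remaining pentagon relations are formal. They are inherited under `V ↦ Σ V⁻¹ Σ`, since inverting
the relation reverses the order of its factors and exchanging the first and third legs restores it
(`Pentagon.flip_inv`), and under conjugation by `u ⊗ u` with `u² = 1` (`Pentagon.conj`).

Regularity rests on a partial transpose. If a unitary `W` of `L²(X × X)` satisfies `⟪η ⊗ a, V(ξ ⊗
ζ)⟫ = ⟪a ⊗ ξ̄, W(ζ ⊗ η̄)⟫`, then slicing `ΣV` by `⟪η, · ζ⟫` gives the Hilbert–Schmidt operator with
kernel `W(ζ ⊗ η̄)`. Normal functionals therefore give only compact operators, and because `W` is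
onto, the slices are dense among the Hilbert–Schmidt operators, hence among the compact ones
(`HasUnitaryPartialTranspose.regular`). For `U_A` the operator `W` is an explicit weighted
composition operator (`hasUnitaryPartialTranspose_heisU`). Having such a `W` passes from `V` to `Σ
V* Σ` and to `V̂`, and so to `(j ⊗ j)V(j ⊗ j)`, which is the double hat. All eight operators are
thereby covered. -/

theorem hilbertTensor_induction {p : HilbertTensor H K → Prop} (hc : IsClosed {z | p z})
    (h0 : p 0) (hadd : ∀ x y, p x → p y → p (x + y))
    (hmul : ∀ x y, p (tensorIncl H K (x ⊗ₜ y))) (z : HilbertTensor H K) : p z := by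
  refine (denseRange_tensorIncl H K).induction_on z hc fun a => ?_
  induction a using TensorProduct.induction_on with
  | zero => simpa using h0
  | tmul x y => exact hmul x y
  | add x y hx hy =>
    rw [map_add]
    exact hadd _ _ hx hy

theorem hilbertTensor_ext {E : Type*} [NormedAddCommGroup E] [NormedSpace ℂ E]
    {S T : HilbertTensor H K →L[ℂ] E}
    (h : ∀ x y, S (tensorIncl H K (x ⊗ₜ y)) = T (tensorIncl H K (x ⊗ₜ y))) : S = T := by
  ext z
  refine hilbertTensor_induction (p := fun z => S z = T z) ?_ ?_ ?_ h z
  · exact isClosed_eq S.continuous T.continuous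
  · simp
  · intro x y hx hy
    rw [map_add, map_add, hx, hy]

theorem inner_tensorIncl_tmul (x x' : H) (y y' : K) :
    ⟪tensorIncl H K (x ⊗ₜ y), tensorIncl H K (x' ⊗ₜ y')⟫_ℂ = ⟪x, x'⟫_ℂ * ⟪y, y'⟫_ℂ := by
  rw [LinearIsometry.inner_map_map, TensorProduct.inner_tmul]

theorem tensorOp_comp (S' : H' →L[ℂ] H'') (T' : K' →L[ℂ] K'') (S : H →L[ℂ] H')
    (T : K →L[ℂ] K') :
    tensorOp S' T' ∘L tensorOp S T = tensorOp (S' ∘L S) (T' ∘L T) :=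
  hilbertTensor_ext fun x y => by simp [tensorOp_tmul]

theorem tensorOp_mul (S S' : H →L[ℂ] H) (T T' : K →L[ℂ] K) :
    tensorOp S T * tensorOp S' T' = tensorOp (S * S') (T * T') :=
  tensorOp_comp _ _ _ _

theorem tensorOp_one_one : tensorOp (1 : H →L[ℂ] H) (1 : K →L[ℂ] K) = 1 :=
  hilbertTensor_ext fun x y => by simp [tensorOp_tmul]

theorem flipOp_flipOp (z : HilbertTensor H K) : flipOp K H (flipOp H K z) = z := by
  have : flipOp K H ∘L flipOp H K = ContinuousLinearMap.id ℂ _ :=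
    hilbertTensor_ext fun x y => by simp [flipOp_tmul]
  exact DFunLike.congr_fun this z

theorem flipOp_mul_flipOp : flipOp H H * flipOp H H = 1 :=
  ContinuousLinearMap.ext flipOp_flipOp

theorem flipOp_comp_tensorOp (S : H →L[ℂ] H') (T : K →L[ℂ] K') :
    flipOp H' K' ∘L tensorOp S T = tensorOp T S ∘L flipOp H K :=
  hilbertTensor_ext fun x y => by simp [tensorOp_tmul, flipOp_tmul]

theorem flipOp_mul_tensorOp (S T : H →L[ℂ] H) :
    flipOp H H * tensorOp S T = tensorOp T S * flipOp H H :=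
  flipOp_comp_tensorOp S T

theorem star_tensorOp [CompleteSpace H] [CompleteSpace K] (S : H →L[ℂ] H) (T : K →L[ℂ] K) :
    star (tensorOp S T) = tensorOp (star S) (star T) := by
  refine hilbertTensor_ext fun x y => ext_inner_left ℂ fun z => ?_
  rw [ContinuousLinearMap.star_eq_adjoint, ContinuousLinearMap.adjoint_inner_right]
  refine hilbertTensor_induction (p := fun z => ⟪tensorOp S T z, tensorIncl H K (x ⊗ₜ y)⟫_ℂ =
    ⟪z, tensorOp (star S) (star T) (tensorIncl H K (x ⊗ₜ y))⟫_ℂ) ?_ ?_ ?_ ?_ z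
  · exact isClosed_eq (by fun_prop) (by fun_prop)
  · simp
  · intro a b ha hb
    rw [map_add, inner_add_left, inner_add_left, ha, hb]
  · intro a b
    simp only [tensorOp_tmul, inner_tensorIncl_tmul, ContinuousLinearMap.star_eq_adjoint,
      ContinuousLinearMap.adjoint_inner_right]

theorem star_flipOp [CompleteSpace H] : star (flipOp H H) = flipOp H H := by
  refine hilbertTensor_ext fun x y => ext_inner_left ℂ fun z => ?_
  rw [ContinuousLinearMap.star_eq_adjoint, ContinuousLinearMap.adjoint_inner_right]
  refine hilbertTensor_induction (p := fun z => ⟪flipOp H H z, tensorIncl H H (x ⊗ₜ y)⟫_ℂ =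
    ⟪z, flipOp H H (tensorIncl H H (x ⊗ₜ y))⟫_ℂ) ?_ ?_ ?_ ?_ z
  · exact isClosed_eq (by fun_prop) (by fun_prop)
  · simp
  · intro a b ha hb
    rw [map_add, inner_add_left, inner_add_left, ha, hb]
  · intro a b
    simp only [flipOp_tmul, inner_tensorIncl_tmul]
    ring

theorem tensorOp_mem_unitary [CompleteSpace H] [CompleteSpace K] {S : H →L[ℂ] H}
    {T : K →L[ℂ] K} (hS : S ∈ unitary (H →L[ℂ] H)) (hT : T ∈ unitary (K →L[ℂ] K)) :
    tensorOp S T ∈ unitary (HilbertTensor H K →L[ℂ] HilbertTensor H K) := by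
  rw [Unitary.mem_iff, star_tensorOp, tensorOp_mul, tensorOp_mul, Unitary.star_mul_self_of_mem hS,
    Unitary.star_mul_self_of_mem hT, Unitary.mul_star_self_of_mem hS,
    Unitary.mul_star_self_of_mem hT, tensorOp_one_one]
  exact ⟨rfl, rfl⟩

theorem flipOp_mem_unitary [CompleteSpace H] :
    flipOp H H ∈ unitary (HilbertTensor H H →L[ℂ] HilbertTensor H H) := by
  rw [Unitary.mem_iff, star_flipOp, flipOp_mul_flipOp]
  exact ⟨rfl, rfl⟩

/-- Density is used twice: with `z` fixed, `Z ↦ Z ⊗ z` is continuous and linear, so elementary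
tensors in the inner factor suffice. -/
theorem hilbertTensor_ext_left {E : Type*} [NormedAddCommGroup E] [NormedSpace ℂ E]
    {S T : HilbertTensor (HilbertTensor H K) L →L[ℂ] E}
    (h : ∀ x y z, S (tensorIncl _ _ (tensorIncl H K (x ⊗ₜ y) ⊗ₜ z)) =
      T (tensorIncl _ _ (tensorIncl H K (x ⊗ₜ y) ⊗ₜ z))) : S = T := by
  refine hilbertTensor_ext fun Z z => ?_
  have : S ∘L (leftTensor (HilbertTensor H K) L).flip z =
      T ∘L (leftTensor (HilbertTensor H K) L).flip z :=
    hilbertTensor_ext fun x y => h x y z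
  exact DFunLike.congr_fun this Z

end TensorAlgebra

/-! ### Leg numbering and the stability of the pentagon relation. -/

section Legs

variable {H : Type*} [NormedAddCommGroup H] [InnerProductSpace ℂ H]

theorem leg12_mul (S T : HilbertTensor H H →L[ℂ] HilbertTensor H H) :
    leg12 (S * T) = leg12 S * leg12 T := by
  rw [leg12, leg12, leg12, ← ContinuousLinearMap.one_def, tensorOp_mul, one_mul]

theorem leg23_mul (S T : HilbertTensor H H →L[ℂ] HilbertTensor H H) :
    leg23 (S * T) = leg23 S * leg23 T := by
  have h : tensorOp (ContinuousLinearMap.id ℂ H) (S * T) =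
      tensorOp (ContinuousLinearMap.id ℂ H) S ∘L tensorOp (ContinuousLinearMap.id ℂ H) T := by
    rw [tensorOp_comp]
    rfl
  ext Z
  simp [leg23, h]

theorem leg12_one : leg12 (1 : HilbertTensor H H →L[ℂ] HilbertTensor H H) = 1 :=
  tensorOp_one_one

theorem leg23_one : leg23 (1 : HilbertTensor H H →L[ℂ] HilbertTensor H H) = 1 := by
  have : tensorOp (ContinuousLinearMap.id ℂ H) (1 : HilbertTensor H H →L[ℂ] HilbertTensor H H) = 1 :=
    tensorOp_one_one
  ext Z
  simp [leg23, this]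

/-- `T₁₂` moved by the cyclic permutation of the legs. -/
theorem leg12_eq_conj (T : HilbertTensor H H →L[ℂ] HilbertTensor H H) :
    leg12 (flipOp H H) * leg23 (flipOp H H) * leg12 T =
      leg23 T * (leg12 (flipOp H H) * leg23 (flipOp H H)) := by
  -- After reassociation `Σ₁₂ Σ₂₃` is one flip, `(x ⊗ y) ⊗ z ↦ z ⊗ (x ⊗ y)`, and a flip exchanges `T
  -- ⊗ 1` with `1 ⊗ T`.
  have hC : ((assocOp H H H).toContinuousLinearEquiv : _ →L[ℂ] _) ∘L
      (leg12 (flipOp H H) * leg23 (flipOp H H)) = flipOp (HilbertTensor H H) H := by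
    have hsymm : ∀ x y z : H, (assocOp H H H).symm
        (tensorIncl _ _ (x ⊗ₜ tensorIncl H H (y ⊗ₜ z))) =
        tensorIncl _ _ (tensorIncl H H (x ⊗ₜ y) ⊗ₜ z) := fun x y z => by
      rw [← assocOp_tmul, LinearIsometryEquiv.symm_apply_apply]
    refine hilbertTensor_ext_left fun x y z => ?_
    simp [leg12, leg23, assocOp_tmul, tensorOp_tmul, flipOp_tmul, hsymm]
  have h1 : flipOp (HilbertTensor H H) H ∘L leg12 T =
      tensorOp (ContinuousLinearMap.id ℂ H) T ∘L flipOp (HilbertTensor H H) H :=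
    flipOp_comp_tensorOp _ _
  ext Z
  apply (assocOp H H H).injective
  have h2 := DFunLike.congr_fun h1 Z
  have h3 := DFunLike.congr_fun hC (leg12 T Z)
  have h4 := DFunLike.congr_fun hC Z
  simp only [ContinuousLinearMap.comp_apply,
    ContinuousLinearEquiv.coe_coe, LinearIsometryEquiv.coe_toContinuousLinearEquiv] at h2 h3 h4 ⊢
  change assocOp H H H ((leg12 (flipOp H H) * leg23 (flipOp H H)) (leg12 T Z)) = _
  rw [h3, h2, ← h4]
  simp [leg23]

theorem leg12_flipOp_mul_self : leg12 (flipOp H H) * leg12 (flipOp H H) = 1 := by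
  rw [← leg12_mul, flipOp_mul_flipOp, leg12_one]

theorem leg23_flipOp_mul_self : leg23 (flipOp H H) * leg23 (flipOp H H) = 1 := by
  rw [← leg23_mul, flipOp_mul_flipOp, leg23_one]

theorem leg13_mul (S T : HilbertTensor H H →L[ℂ] HilbertTensor H H) :
    leg13 (S * T) = leg13 S * leg13 T := by
  change leg23 (flipOp H H) * (leg12 (S * T) * leg23 (flipOp H H)) =
    leg23 (flipOp H H) * (leg12 S * leg23 (flipOp H H)) *
      (leg23 (flipOp H H) * (leg12 T * leg23 (flipOp H H)))
  rw [leg12_mul]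
  simp only [mul_assoc]
  rw [← mul_assoc (leg23 (flipOp H H)) (leg23 (flipOp H H)), leg23_flipOp_mul_self, one_mul]

theorem leg13_eq (T : HilbertTensor H H →L[ℂ] HilbertTensor H H) :
    leg13 T = leg23 (flipOp H H) * leg12 T * leg23 (flipOp H H) := rfl

theorem leg13_one : leg13 (1 : HilbertTensor H H →L[ℂ] HilbertTensor H H) = 1 := by
  rw [leg13_eq, leg12_one, mul_one, leg23_flipOp_mul_self]

/-- The pentagon relation. -/
def Pentagon (V : HilbertTensor H H →L[ℂ] HilbertTensor H H) : Prop :=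
  leg12 V * leg13 V * leg23 V = leg23 V * leg12 V

/-- The exchange of the first and the third leg. -/
noncomputable def flip13 : HilbertTensor (HilbertTensor H H) H →L[ℂ] HilbertTensor (HilbertTensor H H) H :=
  leg12 (flipOp H H) * leg23 (flipOp H H) * leg12 (flipOp H H)

theorem flip13_mul_self : (flip13 : HilbertTensor (HilbertTensor H H) H →L[ℂ] _) * flip13 = 1 := by
  have ha := leg12_flipOp_mul_self (H := H)
  have hb := leg23_flipOp_mul_self (H := H)
  rw [flip13]
  set a := leg12 (flipOp H H)
  set b := leg23 (flipOp H H)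
  calc a * b * a * (a * b * a) = a * b * (a * a) * b * a := by simp only [mul_assoc]
    _ = a * (b * b) * a := by rw [ha]; simp only [mul_assoc, one_mul]
    _ = 1 := by rw [hb, mul_one, ha]

theorem leg12_flip_conj (T : HilbertTensor H H →L[ℂ] HilbertTensor H H) :
    flip13 * leg12 (flipOp H H * T * flipOp H H) = leg23 T * flip13 := by
  have ha := leg12_flipOp_mul_self (H := H)
  have h := leg12_eq_conj T
  rw [flip13, leg12_mul, leg12_mul]
  set a := leg12 (flipOp H H)
  set b := leg23 (flipOp H H)
  calc a * b * a * (a * leg12 T * a) = a * b * (a * a) * leg12 T * a := by simp only [mul_assoc]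
    _ = leg23 T * (a * b) * a := by rw [ha, mul_one, h]
    _ = _ := by simp only [mul_assoc]

theorem leg23_flip_conj (T : HilbertTensor H H →L[ℂ] HilbertTensor H H) :
    flip13 * leg23 (flipOp H H * T * flipOp H H) = leg12 T * flip13 := by
  have h := leg12_flip_conj (flipOp H H * T * flipOp H H)
  have hT : flipOp H H * (flipOp H H * T * flipOp H H) * flipOp H H = T := by
    rw [show flipOp H H * (flipOp H H * T * flipOp H H) * flipOp H H =
      (flipOp H H * flipOp H H) * T * (flipOp H H * flipOp H H) by simp only [mul_assoc],
      flipOp_mul_flipOp, one_mul, mul_one]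
  rw [hT] at h
  have hP := flip13_mul_self (H := H)
  calc flip13 * leg23 (flipOp H H * T * flipOp H H)
      = flip13 * (leg23 (flipOp H H * T * flipOp H H) * flip13) * flip13 := by
        simp only [mul_assoc, hP, mul_one]
    _ = (flip13 * flip13) * leg12 T * flip13 := by rw [← h]; simp only [mul_assoc]
    _ = _ := by rw [hP, one_mul]

/-- The extra ingredient is the braid relation `Σ₁₂ Σ₂₃ Σ₁₂ = Σ₂₃ Σ₁₂ Σ₂₃`, which is `leg12_eq_conj`
for `T = Σ`. -/
theorem leg13_flip_conj (T : HilbertTensor H H →L[ℂ] HilbertTensor H H) :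
    flip13 * leg13 (flipOp H H * T * flipOp H H) = leg13 T * flip13 := by
  have ha := leg12_flipOp_mul_self (H := H)
  have hb := leg23_flipOp_mul_self (H := H)
  have hbraid := leg12_eq_conj (flipOp H H)
  have h := leg12_eq_conj T
  rw [leg13_eq, leg13_eq, flip13, leg12_mul, leg12_mul]
  set a := leg12 (flipOp H H)
  set b := leg23 (flipOp H H)
  have hbraid' : a * b * a = b * a * b := by rw [hbraid]; simp only [mul_assoc]
  calc a * b * a * (b * (a * leg12 T * a) * b)
      = a * b * (a * b * a) * leg12 T * a * b := by simp only [mul_assoc]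
    _ = a * (b * b) * a * b * leg12 T * a * b := by rw [hbraid']; simp only [mul_assoc]
    _ = b * leg12 T * (a * b) := by rw [hb, mul_one, ha, one_mul]; simp only [mul_assoc]
    _ = b * leg12 T * (b * b) * (a * b) := by rw [hb, mul_one]
    _ = b * leg12 T * b * (b * a * b) := by simp only [mul_assoc]
    _ = _ := by rw [← hbraid']

/-- Applied with `V' = V*`, this handles the operators `Σ X* Σ`. -/
theorem Pentagon.flip_inv {V V' : HilbertTensor H H →L[ℂ] HilbertTensor H H} (h : Pentagon V)
    (h1 : V * V' = 1) (h2 : V' * V = 1) : Pentagon (flipOp H H * V' * flipOp H H) := by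
  have hP := flip13_mul_self (H := H)
  -- The pentagon relation with both sides inverted. Conjugation by `flip13` then interchanges the
  -- indices 1 and 3, which puts the factors back in pentagon order.
  have key : leg23 V' * leg13 V' * leg12 V' = leg12 V' * leg23 V' := by
    have a1 : leg12 V * leg12 V' = 1 := by rw [← leg12_mul, h1, leg12_one]
    have b1 : leg13 V * leg13 V' = 1 := by rw [← leg13_mul, h1, leg13_one]
    have c1 : leg23 V * leg23 V' = 1 := by rw [← leg23_mul, h1, leg23_one]
    have a2 : leg12 V' * leg12 V = 1 := by rw [← leg12_mul, h2, leg12_one]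
    have c2 : leg23 V' * leg23 V = 1 := by rw [← leg23_mul, h2, leg23_one]
    unfold Pentagon at h
    generalize leg12 V = a at *
    generalize leg13 V = b at *
    generalize leg23 V = c at *
    generalize leg12 V' = a' at *
    generalize leg13 V' = b' at *
    generalize leg23 V' = c' at *
    calc c' * b' * a' = (a' * (c' * c) * a) * (c' * b' * a') := by rw [c2, mul_one, a2, one_mul]
      _ = a' * c' * (c * a) * (c' * b' * a') := by simp only [mul_assoc]
      _ = a' * c' * (a * b * c) * (c' * b' * a') := by rw [h]
      _ = a' * c' * (a * (b * (c * c') * b') * a') := by simp only [mul_assoc]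
      _ = a' * c' := by rw [c1, mul_one, b1, mul_one, a1, mul_one]
  have e12 := leg12_flip_conj V'
  have e13 := leg13_flip_conj V'
  have e23 := leg23_flip_conj V'
  unfold Pentagon
  generalize leg12 (flipOp H H * V' * flipOp H H) = a at *
  generalize leg13 (flipOp H H * V' * flipOp H H) = b at *
  generalize leg23 (flipOp H H * V' * flipOp H H) = c at *
  have : flip13 * (a * b * c) = flip13 * (c * a) := by
    calc flip13 * (a * b * c) = (flip13 * a) * b * c := by simp only [mul_assoc]
      _ = leg23 V' * (flip13 * b) * c := by rw [e12]; simp only [mul_assoc]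
      _ = leg23 V' * leg13 V' * (flip13 * c) := by rw [e13]; simp only [mul_assoc]
      _ = leg23 V' * leg13 V' * leg12 V' * flip13 := by rw [e23]; simp only [mul_assoc]
      _ = leg12 V' * (leg23 V' * flip13) := by rw [key]; simp only [mul_assoc]
      _ = leg12 V' * flip13 * a := by rw [← e12]; simp only [mul_assoc]
      _ = _ := by rw [← e23]; simp only [mul_assoc]
  calc a * b * c = flip13 * (flip13 * (a * b * c)) := by rw [← mul_assoc, hP, one_mul]
    _ = c * a := by rw [this, ← mul_assoc, hP, one_mul]

/-- Conjugating by `u ⊗ u ⊗ u` leaves `u²` on the third leg. The factor `1 ⊗ u²` accounts for it and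
disappears when `u² = 1`. -/
theorem leg12_tensorOp_comm (T : HilbertTensor H H →L[ℂ] HilbertTensor H H) (u : H →L[ℂ] H) :
    leg12 (tensorOp u u * T * tensorOp u u) * tensorOp 1 (u * u) =
      tensorOp (tensorOp u u) u * leg12 T * tensorOp (tensorOp u u) u := by
  rw [leg12, leg12, ← ContinuousLinearMap.one_def]
  simp only [tensorOp_mul, mul_one, one_mul]

theorem leg23_tensorOp_tensorOp (T : HilbertTensor H H →L[ℂ] HilbertTensor H H) {u : H →L[ℂ] H}
    (hu : u * u = 1) : leg23 (tensorOp u u * T * tensorOp u u) =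
      tensorOp (tensorOp u u) u * leg23 T * tensorOp (tensorOp u u) u := by
  have hA : ((assocOp H H H).toContinuousLinearEquiv : _ →L[ℂ] _) ∘L tensorOp (tensorOp u u) u =
      tensorOp u (tensorOp u u) ∘L ((assocOp H H H).toContinuousLinearEquiv : _ →L[ℂ] _) :=
    hilbertTensor_ext_left fun x y z => by simp [tensorOp_tmul, assocOp_tmul]
  have hT : tensorOp (ContinuousLinearMap.id ℂ H) (tensorOp u u * T * tensorOp u u) =
      tensorOp u (tensorOp u u) * tensorOp (ContinuousLinearMap.id ℂ H) T *
        tensorOp u (tensorOp u u) := by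
    rw [← ContinuousLinearMap.one_def, tensorOp_mul, tensorOp_mul, mul_one, hu]
  have hA' : ∀ Z, assocOp H H H (tensorOp (tensorOp u u) u Z) =
      tensorOp u (tensorOp u u) (assocOp H H H Z) := fun Z => DFunLike.congr_fun hA Z
  ext Z
  apply (assocOp H H H).injective
  simp [leg23, hT, hA']

/-- All three legs are conjugated by the same involution `u ⊗ u ⊗ u`, so the inner copies cancel.
For the leg 13 this needs `Σ₂₃` to commute with that involution. -/
theorem Pentagon.conj {V : HilbertTensor H H →L[ℂ] HilbertTensor H H} (h : Pentagon V)
    {u : H →L[ℂ] H} (hu : u * u = 1) : Pentagon (tensorOp u u * V * tensorOp u u) := by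
  have huu : tensorOp u u * tensorOp u u = 1 := by rw [tensorOp_mul, hu, tensorOp_one_one]
  have hJ : tensorOp (tensorOp u u) u * tensorOp (tensorOp u u) u = 1 := by
    rw [tensorOp_mul, hu, huu, tensorOp_one_one]
  have e12 : leg12 (tensorOp u u * V * tensorOp u u) =
      tensorOp (tensorOp u u) u * leg12 V * tensorOp (tensorOp u u) u := by
    rw [← leg12_tensorOp_comm, hu, tensorOp_one_one, mul_one]
  have e23 := leg23_tensorOp_tensorOp V hu
  have hF : leg23 (flipOp H H) =
      tensorOp (tensorOp u u) u * leg23 (flipOp H H) * tensorOp (tensorOp u u) u := by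
    rw [← leg23_tensorOp_tensorOp _ hu, ← flipOp_mul_tensorOp, mul_assoc, huu, mul_one]
  have e13 : leg13 (tensorOp u u * V * tensorOp u u) =
      tensorOp (tensorOp u u) u * leg13 V * tensorOp (tensorOp u u) u := by
    rw [leg13_eq, e12, leg13_eq]
    set J := tensorOp (tensorOp u u) u
    set F := leg23 (flipOp H H)
    have hFJ : F * J = J * F := by
      calc F * J = (J * F * J) * J := by rw [← hF]
        _ = J * F * (J * J) := by simp only [mul_assoc]
        _ = J * F := by rw [hJ, mul_one]
    calc F * (J * leg12 V * J) * F = (F * J) * leg12 V * (J * F) := by simp only [mul_assoc]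
      _ = (J * F) * leg12 V * (F * J) := by rw [hFJ]
      _ = _ := by simp only [mul_assoc]
  unfold Pentagon at h ⊢
  rw [e12, e13, e23]
  set J := tensorOp (tensorOp u u) u
  generalize leg12 V = a at *
  generalize leg13 V = b at *
  generalize leg23 V = c at *
  calc J * a * J * (J * b * J) * (J * c * J) = J * a * (J * J) * b * (J * J) * c * J := by
        simp only [mul_assoc]
    _ = J * (a * b * c) * J := by rw [hJ, mul_one]; simp only [mul_assoc, one_mul]
    _ = J * c * (J * J) * a * J := by rw [h, hJ, mul_one]; simp only [mul_assoc]
    _ = _ := by simp only [mul_assoc]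

end Legs

/-! ### Formal identities for the hat and the tilde. -/

section HatTilde

variable {H : Type*} [NormedAddCommGroup H] [InnerProductSpace ℂ H]

theorem flip_tensorOp_flip (S T : H →L[ℂ] H) :
    flipOp H H * tensorOp S T * flipOp H H = tensorOp T S := by
  rw [flipOp_mul_tensorOp, mul_assoc, flipOp_mul_flipOp, mul_one]

theorem hatOp_hatOp (u : H →L[ℂ] H) (V : HilbertTensor H H →L[ℂ] HilbertTensor H H) :
    hatOp u (hatOp u V) = tensorOp u u * V * tensorOp u u := by
  have h : flipOp H H * tensorOp u 1 * flipOp H H * tensorOp u 1 = tensorOp u u := by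
    rw [flip_tensorOp_flip, tensorOp_mul, one_mul, mul_one]
  have h' : tensorOp u 1 * (flipOp H H * tensorOp u 1 * flipOp H H) = tensorOp u u := by
    rw [flip_tensorOp_flip, tensorOp_mul, one_mul, mul_one]
  -- The two copies of `u ⊗ u` must be expanded differently, as `Σ(u ⊗ 1)Σ(u ⊗ 1)` on the left of
  -- `V` and as `(u ⊗ 1)Σ(u ⊗ 1)Σ` on the right. The sides then differ only by associativity.
  rw [← h]
  nth_rewrite 2 [h]
  rw [← h']
  simp only [hatOp, mul_assoc]

/-- This reconciles the tilde operation with the third operator of `IsKacSystem`, so that the tilde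
inherits its properties from the hat. -/
theorem tildeOp_eq (u : H →L[ℂ] H) (V : HilbertTensor H H →L[ℂ] HilbertTensor H H)
    (hu : u * u = 1) : tildeOp u V = tensorOp u u * hatOp u V * tensorOp u u := by
  have h : tensorOp u u * (flipOp H H * tensorOp u 1) = tensorOp u 1 * flipOp H H := by
    rw [flipOp_mul_tensorOp, ← mul_assoc, tensorOp_mul, mul_one, hu]
  have h' : tensorOp u 1 * flipOp H H * tensorOp u u = flipOp H H * tensorOp u 1 := by
    rw [mul_assoc, flipOp_mul_tensorOp, ← mul_assoc, tensorOp_mul, hu, one_mul, flipOp_mul_tensorOp]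
  calc tildeOp u V = (tensorOp u 1 * flipOp H H) * V * (flipOp H H * tensorOp u 1) := by
        simp only [tildeOp, mul_assoc]
    _ = tensorOp u u * (flipOp H H * tensorOp u 1) * V *
        (tensorOp u 1 * flipOp H H * tensorOp u u) := by rw [h, h']
    _ = _ := by simp only [hatOp, mul_assoc]

theorem tildeOp_tildeOp (u : H →L[ℂ] H) (V : HilbertTensor H H →L[ℂ] HilbertTensor H H) :
    tildeOp u (tildeOp u V) = tensorOp u u * V * tensorOp u u := by
  have h : tensorOp u 1 * (flipOp H H * tensorOp u 1 * flipOp H H) = tensorOp u u := by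
    rw [flip_tensorOp_flip, tensorOp_mul, one_mul, mul_one]
  have h' : flipOp H H * tensorOp u 1 * flipOp H H * tensorOp u 1 = tensorOp u u := by
    rw [flip_tensorOp_flip, tensorOp_mul, one_mul, mul_one]
  rw [← h]
  nth_rewrite 2 [h]
  rw [← h']
  simp only [tildeOp, mul_assoc]

theorem hatOp_mem_unitary [CompleteSpace H] {u : H →L[ℂ] H} (hu : u ∈ unitary (H →L[ℂ] H))
    {V : HilbertTensor H H →L[ℂ] HilbertTensor H H}
    (hV : V ∈ unitary (HilbertTensor H H →L[ℂ] HilbertTensor H H)) :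
    hatOp u V ∈ unitary (HilbertTensor H H →L[ℂ] HilbertTensor H H) := by
  have h1 := tensorOp_mem_unitary hu (one_mem (unitary (H →L[ℂ] H)))
  have h2 := flipOp_mem_unitary (H := H)
  exact mul_mem (mul_mem (mul_mem (mul_mem h2 h1) hV) h1) h2

end HatTilde

/-! ### A criterion for regularity -/

section Approximation

/-- With `W` the span of a finite `ε`-net for the image of the unit ball, the approximant is `P_W
S`. In an orthonormal basis `e` of `W` it reads `∑ e_i ⟪S* e_i, ·⟫`. -/
theorem exists_finiteRank_norm_sub_le {H : Type*} [NormedAddCommGroup H] [InnerProductSpace ℂ H]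
    [CompleteSpace H] {S : H →L[ℂ] H} (hS : IsCompactOperator S) {ε : ℝ} (hε : 0 < ε) :
    ∃ (m : ℕ) (a b : Fin m → H),
      ‖S - ∑ i, InnerProductSpace.rankOne ℂ (a i) (b i)‖ ≤ ε := by
  have htot : TotallyBounded (S '' Metric.closedBall 0 1) :=
    (hS.isCompact_closure_image_closedBall 1).totallyBounded.subset subset_closure
  obtain ⟨t, ht, hcov⟩ := Metric.totallyBounded_iff.1 htot ε hε
  let W : Submodule ℂ H := Submodule.span ℂ t
  have : FiniteDimensional ℂ W := FiniteDimensional.span_of_finite ℂ ht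
  let e := stdOrthonormalBasis ℂ W
  refine ⟨_, fun i => (e i : H), fun i => ContinuousLinearMap.adjoint S (e i : H), ?_⟩
  have hsum : ∀ x, (∑ i, InnerProductSpace.rankOne ℂ ((e i : W) : H)
      (ContinuousLinearMap.adjoint S (e i : H))) x = W.starProjection (S x) := by
    intro x
    have h1 := congrArg (fun w : W => (w : H)) (e.sum_repr' (W.orthogonalProjectionOnto (S x)))
    simp only [Submodule.coe_sum, Submodule.coe_smul] at h1
    rw [Submodule.starProjection_apply, ← h1]
    simp only [sum_apply, InnerProductSpace.rankOne_apply,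
      ContinuousLinearMap.adjoint_inner_left]
    refine Finset.sum_congr rfl fun i _ => ?_
    rw [Submodule.coe_inner, ← Submodule.starProjection_apply,
      ← Submodule.inner_starProjection_left_eq_right, Submodule.starProjection_eq_self_iff.2 (e i).2]
  refine ContinuousLinearMap.opNorm_le_of_unit_norm hε.le fun x hx => ?_
  obtain ⟨y, hy, hxy⟩ := Set.mem_iUnion₂.1 (hcov ⟨x, by simp [hx], rfl⟩)
  -- The projection realises the distance from `S x` to `W`, which is at most the distance to the
  -- net point `y`.
  rw [sub_apply, hsum, Submodule.starProjection_minimal]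
  have hyW : y ∈ W := Submodule.subset_span hy
  refine (ciInf_le ⟨0, ?_⟩ (⟨y, hyW⟩ : W)).trans ?_
  · rintro _ ⟨w, rfl⟩
    exact norm_nonneg _
  · rw [← dist_eq_norm]
    exact (Metric.mem_ball.1 hxy).le

theorem isCompactOperator_rankOne {H : Type*} [NormedAddCommGroup H] [InnerProductSpace ℂ H]
    (a b : H) : IsCompactOperator (InnerProductSpace.rankOne ℂ a b) := by
  rw [InnerProductSpace.rankOne_def']
  have : IsCompactOperator (ContinuousLinearMap.toSpanSingleton ℂ a) :=
    isCompactOperator_of_locallyCompactSpace_rng _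
  exact this.comp_clm _

end Approximation

/-! ### Complex conjugation and product functions in `L²`. -/

section Conjugation

variable {X : Type*} [MeasurableSpace X] {μ : Measure X}

theorem lpConj_lpConj (f : Lp ℂ 2 μ) : lpConj μ (lpConj μ f) = f := star_star f

theorem inner_lpConj_lpConj (f g : Lp ℂ 2 μ) : ⟪lpConj μ f, lpConj μ g⟫_ℂ = ⟪g, f⟫_ℂ := by
  rw [L2.inner_def, L2.inner_def]
  refine integral_congr_ae ?_
  filter_upwards [coeFn_lpConj f, coeFn_lpConj g] with x h1 h2
  rw [h1, h2, RCLike.inner_apply, RCLike.inner_apply, Complex.conj_conj]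
  ring

theorem inner_lpConj_left (f g : Lp ℂ 2 μ) : ⟪lpConj μ f, g⟫_ℂ = ⟪lpConj μ g, f⟫_ℂ := by
  rw [← inner_lpConj_lpConj, lpConj_lpConj]

variable {Y : Type*} [MeasurableSpace Y] {ν : Measure Y} [SigmaFinite μ] [SigmaFinite ν]

theorem lpConj_lpMul (f : Lp ℂ 2 μ) (g : Lp ℂ 2 ν) :
    lpConj (μ.prod ν) (lpMul μ ν f g) = lpMul μ ν (lpConj μ f) (lpConj ν g) := by
  apply Lp.ext
  filter_upwards [coeFn_lpConj (lpMul μ ν f g), coeFn_lpMul f g,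
    coeFn_lpMul (lpConj μ f) (lpConj ν g),
    Measure.quasiMeasurePreserving_fst.ae_eq_comp (coeFn_lpConj f),
    Measure.quasiMeasurePreserving_snd.ae_eq_comp (coeFn_lpConj g)] with p h1 h2 h3 h4 h5
  simp only [Function.comp_apply] at h4 h5
  rw [h1, h2, h3, h4, h5, map_mul]

theorem norm_lpMul (f : Lp ℂ 2 μ) (g : Lp ℂ 2 ν) : ‖lpMul μ ν f g‖ = ‖f‖ * ‖g‖ := by
  rw [← lpTensorEquiv_tmul, LinearIsometryEquiv.norm_map, LinearIsometry.norm_map,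
    TensorProduct.norm_tmul]

theorem lpMul_add_left (f f' : Lp ℂ 2 μ) (g : Lp ℂ 2 ν) :
    lpMul μ ν (f + f') g = lpMul μ ν f g + lpMul μ ν f' g := (lpMulₗ μ ν).map_add₂ f f' g

theorem lpMul_add_right (f : Lp ℂ 2 μ) (g g' : Lp ℂ 2 ν) :
    lpMul μ ν f (g + g') = lpMul μ ν f g + lpMul μ ν f g' := (lpMulₗ μ ν f).map_add g g'

theorem lpMul_smul_left (c : ℂ) (f : Lp ℂ 2 μ) (g : Lp ℂ 2 ν) :
    lpMul μ ν (c • f) g = c • lpMul μ ν f g := (lpMulₗ μ ν).map_smul₂ c f g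

theorem lpMul_smul_right (c : ℂ) (f : Lp ℂ 2 μ) (g : Lp ℂ 2 ν) :
    lpMul μ ν f (c • g) = c • lpMul μ ν f g := (lpMulₗ μ ν f).map_smul c g

theorem lp_prod_induction {p : Lp ℂ 2 (μ.prod ν) → Prop} (hc : IsClosed {z | p z}) (h0 : p 0)
    (hadd : ∀ x y, p x → p y → p (x + y)) (hmul : ∀ f g, p (lpMul μ ν f g))
    (z : Lp ℂ 2 (μ.prod ν)) : p z := by
  rw [← (lpTensorEquiv μ ν).apply_symm_apply z]
  refine hilbertTensor_induction (p := fun z => p (lpTensorEquiv μ ν z))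
    (hc.preimage (lpTensorEquiv μ ν).continuous) (by rwa [map_zero]) ?_ ?_ _
  · intro x y hx hy
    rw [map_add]
    exact hadd _ _ hx hy
  · intro x y
    rw [lpTensorEquiv_tmul]
    exact hmul x y

end Conjugation

/-! ### Hilbert–Schmidt kernels, partial transposes and regularity. -/

section KernelOperator

variable {X : Type*} [MeasurableSpace X] (μ : Measure X) [SigmaFinite μ]

/-- Multiplication by a function of the second variable. -/
noncomputable def lpMulRight (g : Lp ℂ 2 μ) : Lp ℂ 2 μ →L[ℂ] Lp ℂ 2 (μ.prod μ) :=
  LinearMap.mkContinuous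
    { toFun := fun f => lpMul μ μ f g
      map_add' := fun f f' => lpMul_add_left f f' g
      map_smul' := fun c f => lpMul_smul_left c f g } ‖g‖
    (fun f => by
      change ‖lpMul μ μ f g‖ ≤ _
      rw [norm_lpMul, mul_comm])

theorem lpMulRight_apply (f g : Lp ℂ 2 μ) : lpMulRight μ g f = lpMul μ μ f g := rfl

theorem norm_lpMulRight_le (g : Lp ℂ 2 μ) : ‖lpMulRight μ g‖ ≤ ‖g‖ :=
  LinearMap.mkContinuous_norm_le _ (norm_nonneg _) _

theorem inner_adjoint_lpMulRight (a b : Lp ℂ 2 μ) (F : Lp ℂ 2 (μ.prod μ)) :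
    ⟪a, ContinuousLinearMap.adjoint (lpMulRight μ b) F⟫_ℂ = ⟪lpMul μ μ a b, F⟫_ℂ := by
  rw [ContinuousLinearMap.adjoint_inner_right, lpMulRight_apply]

/-- The Hilbert–Schmidt operator with a given kernel. -/
noncomputable def kernelOp : Lp ℂ 2 (μ.prod μ) →L[ℂ] Lp ℂ 2 μ →L[ℂ] Lp ℂ 2 μ :=
  LinearMap.mkContinuous₂
    (LinearMap.mk₂ ℂ
      -- This is `∫ F(x, y) ξ(y) dy`. Conjugating `ξ` offsets the antilinearity of the adjoint, so
      -- the expression is linear in `ξ`.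
      (fun F ξ => ContinuousLinearMap.adjoint (lpMulRight μ (lpConj μ ξ)) F)
      (fun F F' ξ => map_add _ F F')
      (fun c F ξ => map_smul _ c F)
      (fun F ξ ξ' => ext_inner_left ℂ fun a => by
        simp only [inner_adjoint_lpMulRight, inner_add_right, inner_add_left, map_add,
          lpMul_add_right])
      (fun c F ξ => ext_inner_left ℂ fun a => by
        simp only [inner_adjoint_lpMulRight, inner_smul_right, inner_smul_left, map_smulₛₗ,
          lpMul_smul_right, Complex.conj_conj])) 1
    (fun F ξ => by
      rw [LinearMap.mk₂_apply, one_mul, mul_comm]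
      refine (ContinuousLinearMap.le_opNorm _ _).trans ?_
      refine mul_le_mul_of_nonneg_right ?_ (norm_nonneg _)
      rw [LinearIsometryEquiv.norm_map]
      exact (norm_lpMulRight_le μ _).trans (LinearIsometry.norm_map _ _).le)

theorem inner_kernelOp (F : Lp ℂ 2 (μ.prod μ)) (a ξ : Lp ℂ 2 μ) :
    ⟪a, kernelOp μ F ξ⟫_ℂ = ⟪lpMul μ μ a (lpConj μ ξ), F⟫_ℂ :=
  inner_adjoint_lpMulRight μ a (lpConj μ ξ) F

theorem kernelOp_lpMul (f g : Lp ℂ 2 μ) :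
    kernelOp μ (lpMul μ μ f g) = InnerProductSpace.rankOne ℂ f (lpConj μ g) := by
  ext1 ξ
  refine ext_inner_left ℂ fun a => ?_
  rw [inner_kernelOp, inner_lpMul, InnerProductSpace.rankOne_apply, inner_smul_right,
    inner_lpConj_left, mul_comm]

/-- Product kernels give rank-one operators and span a dense subspace of kernels. The compact
operators form a closed set, and `kernelOp` is continuous in the kernel. -/
theorem isCompactOperator_kernelOp (F : Lp ℂ 2 (μ.prod μ)) : IsCompactOperator (kernelOp μ F) := by
  refine lp_prod_induction (p := fun F => IsCompactOperator (kernelOp μ F)) ?_ ?_ ?_ ?_ F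
  · exact isClosed_setOfPred_isCompactOperator.preimage (kernelOp μ).continuous
  · rw [map_zero]
    exact isCompactOperator_zero
  · intro F G hF hG
    rw [map_add]
    exact hF.add hG
  · intro f g
    rw [kernelOp_lpMul]
    exact isCompactOperator_rankOne _ _

theorem mem_closure_range_kernelOp {S : Lp ℂ 2 μ →L[ℂ] Lp ℂ 2 μ} (hS : IsCompactOperator S) :
    S ∈ closure (Set.range (kernelOp μ)) := by
  rw [Metric.mem_closure_iff]
  intro ε hε
  obtain ⟨m, a, b, h⟩ := exists_finiteRank_norm_sub_le hS (half_pos hε)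
  refine ⟨_, ⟨∑ i, lpMul μ μ (a i) (lpConj μ (b i)), rfl⟩, ?_⟩
  rw [map_sum, dist_eq_norm]
  simp only [kernelOp_lpMul, lpConj_lpConj]
  exact h.trans_lt (half_lt_self hε)

variable {μ}

/-- The partial transposition of `V` is a unitary operator. -/
def HasUnitaryPartialTranspose
    (V : HilbertTensor (Lp ℂ 2 μ) (Lp ℂ 2 μ) →L[ℂ] HilbertTensor (Lp ℂ 2 μ) (Lp ℂ 2 μ)) : Prop :=
  ∃ W : Lp ℂ 2 (μ.prod μ) ≃ₗᵢ[ℂ] Lp ℂ 2 (μ.prod μ), ∀ a η ξ ζ : Lp ℂ 2 μ,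
    ⟪tensorIncl _ _ (η ⊗ₜ a), V (tensorIncl _ _ (ξ ⊗ₜ ζ))⟫_ℂ =
      ⟪lpMul μ μ a (lpConj μ ξ), W (lpMul μ μ ζ (lpConj μ η))⟫_ℂ

/-- A functional `∑ ⟪η_k, · ζ_k⟫` is encoded by the kernel `F = ∑ ζ_k ⊗ η̄_k`. The flip in `ΣV` is
moved to the left of the inner product, where it turns `a ⊗ η_k` into `η_k ⊗ a`, the form required
by `hW`. -/
theorem rightSlice_eq_kernelOp
    {V : HilbertTensor (Lp ℂ 2 μ) (Lp ℂ 2 μ) →L[ℂ] HilbertTensor (Lp ℂ 2 μ) (Lp ℂ 2 μ)}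
    {W : Lp ℂ 2 (μ.prod μ) ≃ₗᵢ[ℂ] Lp ℂ 2 (μ.prod μ)} (hW : ∀ a η ξ ζ : Lp ℂ 2 μ,
      ⟪tensorIncl _ _ (η ⊗ₜ a), V (tensorIncl _ _ (ξ ⊗ₜ ζ))⟫_ℂ =
        ⟪lpMul μ μ a (lpConj μ ξ), W (lpMul μ μ ζ (lpConj μ η))⟫_ℂ)
    {ω : (Lp ℂ 2 μ →L[ℂ] Lp ℂ 2 μ) →L[ℂ] ℂ} {ζ η : ℕ → Lp ℂ 2 μ}
    (hω : ∀ T, HasSum (fun k => ⟪η k, T (ζ k)⟫_ℂ) (ω T)) {F : Lp ℂ 2 (μ.prod μ)}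
    (hF : HasSum (fun k => lpMul μ μ (ζ k) (lpConj μ (η k))) F) :
    rightSlice ω (flipOp _ _ * V) = kernelOp μ (W F) := by
  ext1 ξ
  refine ext_inner_left ℂ fun a => ?_
  rw [inner_rightSlice, inner_kernelOp]
  refine (hω _).unique ?_
  have h1 : HasSum (fun k => ⟪lpMul μ μ a (lpConj μ ξ),
      W (lpMul μ μ (ζ k) (lpConj μ (η k)))⟫_ℂ) ⟪lpMul μ μ a (lpConj μ ξ), W F⟫_ℂ :=
    (hF.mapL (W : Lp ℂ 2 (μ.prod μ) →L[ℂ] Lp ℂ 2 (μ.prod μ))).mapL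
      (innerSL ℂ (lpMul μ μ a (lpConj μ ξ)))
  convert h1 using 2 with k
  rw [← hW, ContinuousLinearMap.comp_apply, ContinuousLinearMap.adjoint_inner_right,
    ContinuousLinearMap.comp_apply, mul_apply_eq_comp, leftTensor_apply,
    leftTensor_apply, ← ContinuousLinearMap.adjoint_inner_left,
    ← ContinuousLinearMap.star_eq_adjoint, star_flipOp, flipOp_tmul]

theorem HasUnitaryPartialTranspose.regular
    {V : HilbertTensor (Lp ℂ 2 μ) (Lp ℂ 2 μ) →L[ℂ] HilbertTensor (Lp ℂ 2 μ) (Lp ℂ 2 μ)}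
    (h : HasUnitaryPartialTranspose V) :
    closure {S : Lp ℂ 2 μ →L[ℂ] Lp ℂ 2 μ | ∃ ω : (Lp ℂ 2 μ →L[ℂ] Lp ℂ 2 μ) →L[ℂ] ℂ,
      IsNormalFunctional ω ∧ S = rightSlice ω (flipOp _ _ * V)} =
      {S : Lp ℂ 2 μ →L[ℂ] Lp ℂ 2 μ | IsCompactOperator S} := by
  obtain ⟨W, hW⟩ := h
  apply Set.Subset.antisymm
  · refine closure_minimal ?_ isClosed_setOfPred_isCompactOperator
    rintro S ⟨ω, ⟨ζ, η, hζ, hη, hω⟩, rfl⟩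
    -- Absolute convergence: `‖ζ_k‖ ‖η_k‖ ≤ ‖ζ_k‖² + ‖η_k‖²`.
    have hs : Summable fun k => lpMul μ μ (ζ k) (lpConj μ (η k)) := by
      refine Summable.of_norm_bounded (g := fun k => ‖ζ k‖ ^ 2 + ‖η k‖ ^ 2) (hζ.add hη) fun k => ?_
      rw [norm_lpMul, LinearIsometry.norm_map]
      nlinarith [sq_nonneg (‖ζ k‖ - ‖η k‖), sq_nonneg ‖ζ k‖, sq_nonneg ‖η k‖]
    rw [Set.mem_ofPred_eq, rightSlice_eq_kernelOp hW hω hs.hasSum]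
    exact isCompactOperator_kernelOp μ _
  · intro S hS
    refine closure_minimal ?_ isClosed_closure (mem_closure_range_kernelOp μ hS)
    rintro _ ⟨F, rfl⟩
    -- Surjectivity of `W` enters here: every kernel is `W` of some function, which is a limit of
    -- finite sums of products, and such sums come from finite-rank functionals.
    rw [← W.apply_symm_apply F]
    refine (denseRange_lpTensorIncl μ μ).induction_on (p := fun F => kernelOp μ (W F) ∈
      closure {S : Lp ℂ 2 μ →L[ℂ] Lp ℂ 2 μ | ∃ ω : (Lp ℂ 2 μ →L[ℂ] Lp ℂ 2 μ) →L[ℂ] ℂ,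
        IsNormalFunctional ω ∧ S = rightSlice ω (flipOp _ _ * V)}) (W.symm F) ?_ ?_
    · exact isClosed_closure.preimage ((kernelOp μ).continuous.comp W.continuous)
    · intro z
      obtain ⟨m, f, g, rfl⟩ := TensorProduct.exists_sum_tmul_eq z
      -- The finite sum `∑ f_i ⊗ g_i` is extended by zero to sequences, since normal functionals are
      -- indexed by `ℕ`. Each `g_i` is conjugated because the kernel attached to `(ζ, η)` is `ζ ⊗
      -- η̄`.
      let ζ : ℕ → Lp ℂ 2 μ := fun k => if hk : k < m then f ⟨k, hk⟩ else 0
      let η : ℕ → Lp ℂ 2 μ := fun k => if hk : k < m then lpConj μ (g ⟨k, hk⟩) else 0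
      have hζ : ∀ k ∉ Finset.range m, ζ k = 0 := fun k hk => by
        simp only [ζ]
        rw [dif_neg (by simpa using hk)]
      have hη : ∀ k ∉ Finset.range m, η k = 0 := fun k hk => by
        simp only [η]
        rw [dif_neg (by simpa using hk)]
      let ω : (Lp ℂ 2 μ →L[ℂ] Lp ℂ 2 μ) →L[ℂ] ℂ :=
        ∑ k ∈ Finset.range m, (innerSL ℂ (η k)) ∘L (ContinuousLinearMap.apply ℂ _ (ζ k))
      have hω : ∀ T, HasSum (fun k => ⟪η k, T (ζ k)⟫_ℂ) (ω T) := fun T => by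
        have : ω T = ∑ k ∈ Finset.range m, ⟪η k, T (ζ k)⟫_ℂ := by
          simp [ω]
        rw [this]
        exact hasSum_sum_of_ne_finset_zero fun k hk => by rw [hη k hk, inner_zero_left]
      have hF : HasSum (fun k => lpMul μ μ (ζ k) (lpConj μ (η k)))
          (lpTensorIncl μ μ (∑ i, f i ⊗ₜ g i)) := by
        have : lpTensorIncl μ μ (∑ i, f i ⊗ₜ g i) =
            ∑ k ∈ Finset.range m, lpMul μ μ (ζ k) (lpConj μ (η k)) := by
          rw [map_sum, ← Fin.sum_univ_eq_sum_range (fun k => lpMul μ μ (ζ k) (lpConj μ (η k)))]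
          refine Finset.sum_congr rfl fun i _ => ?_
          simp only [ζ, η, i.isLt, dif_pos, lpConj_lpConj]
          rfl
        rw [this]
        exact hasSum_sum_of_ne_finset_zero fun k hk => by
          rw [hζ k hk]
          exact (lpMulₗ μ μ).map_zero₂ _
      refine subset_closure ⟨ω, ⟨ζ, η, ?_, ?_, hω⟩, (rightSlice_eq_kernelOp hW hω hF).symm⟩
      · exact summable_of_ne_finset_zero (s := Finset.range m) fun k hk => by simp [hζ k hk]
      · exact summable_of_ne_finset_zero (s := Finset.range m) fun k hk => by simp [hη k hk]

/-- Complex conjugation as an antiunitary operator. -/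
noncomputable def lpConjEquiv {Y : Type*} [MeasurableSpace Y] (ν : Measure Y) :
    Lp ℂ 2 ν ≃ₗᵢ⋆[ℂ] Lp ℂ 2 ν where
  toFun := lpConj ν
  map_add' := map_add _
  map_smul' := map_smulₛₗ _
  invFun := lpConj ν
  left_inv := lpConj_lpConj
  right_inv := lpConj_lpConj
  norm_map' := (lpConj ν).norm_map

/-- A unitary operator on the tensor square, seen on the functions of two variables. -/
noncomputable def lpUnitary
    (D : unitary (HilbertTensor (Lp ℂ 2 μ) (Lp ℂ 2 μ) →L[ℂ] HilbertTensor (Lp ℂ 2 μ) (Lp ℂ 2 μ))) :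
    Lp ℂ 2 (μ.prod μ) ≃ₗᵢ[ℂ] Lp ℂ 2 (μ.prod μ) :=
  ((lpTensorEquiv μ μ).symm.trans (Unitary.linearIsometryEquiv D)).trans (lpTensorEquiv μ μ)

theorem lpUnitary_lpMul
    (D : unitary (HilbertTensor (Lp ℂ 2 μ) (Lp ℂ 2 μ) →L[ℂ] HilbertTensor (Lp ℂ 2 μ) (Lp ℂ 2 μ)))
    (f g : Lp ℂ 2 μ) : lpUnitary D (lpMul μ μ f g) =
      lpTensorEquiv μ μ (D.1 (tensorIncl _ _ (f ⊗ₜ g))) := by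
  rw [← lpTensorEquiv_tmul]
  simp only [lpUnitary, LinearIsometryEquiv.trans_apply, LinearIsometryEquiv.symm_apply_apply]
  rfl

theorem inner_apply_eq_inner_star {H : Type*} [NormedAddCommGroup H] [InnerProductSpace ℂ H]
    [CompleteSpace H] (T : HilbertTensor H H →L[ℂ] HilbertTensor H H) (x y : HilbertTensor H H) :
    ⟪x, T y⟫_ℂ = ⟪star T x, y⟫_ℂ := by
  rw [ContinuousLinearMap.star_eq_adjoint, ContinuousLinearMap.adjoint_inner_left]

/-- With `C` complex conjugation and `D` the flip on `L²(X × X)`, the new transpose is `D⁻¹ C W C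
D`. Taking the adjoint of `V` conjugates the matrix coefficient, and `C` absorbs this. -/
theorem HasUnitaryPartialTranspose.flip_star
    {V : HilbertTensor (Lp ℂ 2 μ) (Lp ℂ 2 μ) →L[ℂ] HilbertTensor (Lp ℂ 2 μ) (Lp ℂ 2 μ)}
    (h : HasUnitaryPartialTranspose V) :
    HasUnitaryPartialTranspose (flipOp _ _ * star V * flipOp _ _) := by
  obtain ⟨W, hW⟩ := h
  let D := lpUnitary (μ := μ) ⟨_, flipOp_mem_unitary⟩
  have hD : ∀ f g, D (lpMul μ μ f g) = lpMul μ μ g f := fun f g => by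
    simp only [D, lpUnitary_lpMul, flipOp_tmul, lpTensorEquiv_tmul]
  refine ⟨(D.trans ((lpConjEquiv (μ.prod μ)).trans (W.trans (lpConjEquiv (μ.prod μ))))).trans
    D.symm, fun a η ξ ζ => ?_⟩
  have h1 : ∀ F, ((D.trans ((lpConjEquiv (μ.prod μ)).trans
      (W.trans (lpConjEquiv (μ.prod μ))))).trans D.symm) F =
        D.symm (lpConj _ (W (lpConj _ (D F)))) := fun F => rfl
  rw [h1, ← D.inner_map_map, D.apply_symm_apply, hD, hD, lpConj_lpMul, lpConj_lpConj,
    ← lpConj_lpConj (lpMul μ μ (lpConj μ ξ) a), inner_lpConj_lpConj, lpConj_lpMul, lpConj_lpConj,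
    ← inner_conj_symm (W _), ← hW, inner_conj_symm, mul_assoc, mul_apply_eq_comp,
    inner_apply_eq_inner_star, star_flipOp, flipOp_tmul, mul_apply_eq_comp, flipOp_tmul,
    inner_apply_eq_inner_star, star_star]

/-- With `D = Σ(u ⊗ 1)` and `C` complex conjugation, the new transpose is `D⁻¹ C W⁻¹ C D`. The
inverse appears because the flips in `V̂` make `(ζ, η)` play the part of `(ξ, a)` and conversely. -/
theorem HasUnitaryPartialTranspose.hatOp
    {V : HilbertTensor (Lp ℂ 2 μ) (Lp ℂ 2 μ) →L[ℂ] HilbertTensor (Lp ℂ 2 μ) (Lp ℂ 2 μ)}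
    (h : HasUnitaryPartialTranspose V) {u : Lp ℂ 2 μ →L[ℂ] Lp ℂ 2 μ}
    (hu : u ∈ unitary (Lp ℂ 2 μ →L[ℂ] Lp ℂ 2 μ)) (hsu : star u = u) :
    HasUnitaryPartialTranspose (hatOp u V) := by
  obtain ⟨W, hW⟩ := h
  have hu1 := tensorOp_mem_unitary hu (one_mem (unitary (Lp ℂ 2 μ →L[ℂ] Lp ℂ 2 μ)))
  have hstar : star (tensorOp u (1 : Lp ℂ 2 μ →L[ℂ] Lp ℂ 2 μ)) = tensorOp u 1 := by
    rw [star_tensorOp, hsu, star_one]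
  let D := lpUnitary (μ := μ) ⟨_, mul_mem flipOp_mem_unitary hu1⟩
  have hD : ∀ f g, D (lpMul μ μ f g) = lpMul μ μ g (u f) := fun f g => by
    simp only [D, lpUnitary_lpMul, mul_apply_eq_comp, tensorOp_tmul, flipOp_tmul,
      lpTensorEquiv_tmul, one_apply_eq_self]
  refine ⟨(D.trans ((lpConjEquiv (μ.prod μ)).trans (W.symm.trans (lpConjEquiv (μ.prod μ))))).trans
    D.symm, fun a η ξ ζ => ?_⟩
  have h1 : ∀ F, ((D.trans ((lpConjEquiv (μ.prod μ)).trans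
      (W.symm.trans (lpConjEquiv (μ.prod μ))))).trans D.symm) F =
        D.symm (lpConj _ (W.symm (lpConj _ (D F)))) := fun F => rfl
  rw [h1, ← D.inner_map_map, D.apply_symm_apply, hD, hD, lpConj_lpMul, lpConj_lpConj,
    ← lpConj_lpConj (lpMul μ μ (lpConj μ ξ) (u a)), inner_lpConj_lpConj, lpConj_lpMul,
    lpConj_lpConj, ← W.inner_map_map, W.apply_symm_apply, ← hW]
  simp only [_root_.hatOp, mul_assoc]
  rw [mul_apply_eq_comp, inner_apply_eq_inner_star, star_flipOp, flipOp_tmul,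
    mul_apply_eq_comp, inner_apply_eq_inner_star, hstar, tensorOp_tmul,
    mul_apply_eq_comp, mul_apply_eq_comp, flipOp_tmul, tensorOp_tmul]
  rfl

end KernelOperator

/-! ### Calculus of weighted composition operators -/

namespace IsIsometricWeight

variable {X : Type*} [MeasurableSpace X] {μ : Measure X} {φ φ' ψ : X → X} {w w' : X → ℂ}

theorem comp (h : IsIsometricWeight μ φ w) (h' : IsIsometricWeight μ φ' w') :
    IsIsometricWeight μ (fun x => φ' (φ x)) (fun x => w x * w' (φ x)) where
  measurable_map := h'.measurable_map.comp h.measurable_map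
  measurable_weight := h.measurable_weight.mul (h'.measurable_weight.comp h.measurable_map)
  weight_ne_zero x := mul_ne_zero (h.weight_ne_zero x) (h'.weight_ne_zero _)
  lintegral_eq f hf := by
    have hm : Measurable fun x => ‖w' x‖ₑ ^ 2 * f (φ' x) :=
      (h'.measurable_weight.enorm.pow_const 2).mul (hf.comp h'.measurable_map)
    rw [← h'.lintegral_eq f hf, ← h.lintegral_eq _ hm]
    simp only [enorm_mul, mul_pow, mul_assoc]

theorem toIsometry_toIsometry (h : IsIsometricWeight μ φ w) (h' : IsIsometricWeight μ φ' w')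
    (f : Lp ℂ 2 μ) : h.toIsometry (h'.toIsometry f) = (h.comp h').toIsometry f := by
  apply Lp.ext
  filter_upwards [h.coeFn_toIsometry (h'.toIsometry f), (h.comp h').coeFn_toIsometry f,
    h.quasiMeasurePreserving.ae_eq_comp (h'.coeFn_toIsometry f)] with x h1 h2 h3
  simp only [Function.comp_apply] at h3
  rw [h1, h2, h3, mul_assoc]

theorem toIsometry_congr (h : IsIsometricWeight μ φ w) (h' : IsIsometricWeight μ φ' w')
    (hφ : ∀ x, φ x = φ' x) (hw : ∀ x, w x = w' x) (f : Lp ℂ 2 μ) :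
    h.toIsometry f = h'.toIsometry f := by
  obtain rfl : φ = φ' := funext hφ
  obtain rfl : w = w' := funext hw
  rfl

theorem toIsometry_eq_self (h : IsIsometricWeight μ φ w) (hφ : ∀ x, φ x = x) (hw : ∀ x, w x = 1)
    (f : Lp ℂ 2 μ) : h.toIsometry f = f := by
  apply Lp.ext
  filter_upwards [h.coeFn_toIsometry f] with x h1
  rw [h1, hφ, hw, one_mul]

/-- A one-sided inverse of `φ` suffices: the integral formula for `(φ, w)`, read from right to left,
brings in `ψ ∘ φ`, and the weights cancel. -/
theorem inverse (h : IsIsometricWeight μ φ w) (hψ : Measurable ψ)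
    (hψφ : ∀ x, ψ (φ x) = x) : IsIsometricWeight μ ψ (fun x => (w (ψ x))⁻¹) where
  measurable_map := hψ
  measurable_weight := (h.measurable_weight.comp hψ).inv
  weight_ne_zero x := inv_ne_zero (h.weight_ne_zero _)
  lintegral_eq f hf := by
    have hm : Measurable fun x => ‖(w (ψ x))⁻¹‖ₑ ^ 2 * f (ψ x) :=
      ((h.measurable_weight.comp hψ).inv.enorm.pow_const 2).mul (hf.comp hψ)
    rw [← h.lintegral_eq _ hm]
    refine lintegral_congr fun x => ?_
    rw [hψφ, ← mul_assoc, ← mul_pow, ← enorm_mul, mul_inv_cancel₀ (h.weight_ne_zero x), enorm_one,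
      one_pow, one_mul]

/-- Composition operators reverse the order of maps, so a left inverse of the point map yields a
right inverse of the operator. -/
theorem surjective_toIsometry (h : IsIsometricWeight μ φ w) (hψ : Measurable ψ)
    (hψφ : ∀ x, ψ (φ x) = x) : Function.Surjective h.toIsometry := fun f =>
  ⟨(h.inverse hψ hψφ).toIsometry f, by
    rw [toIsometry_toIsometry]
    refine toIsometry_eq_self _ hψφ (fun x => ?_) f
    rw [hψφ, mul_inv_cancel₀ (h.weight_ne_zero x)]⟩

theorem of_measurePreserving (h : MeasurePreserving φ μ μ) : IsIsometricWeight μ φ fun _ => 1 where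
  measurable_map := h.measurable
  measurable_weight := measurable_const
  weight_ne_zero _ := one_ne_zero
  lintegral_eq f hf := by
    simp only [enorm_one, one_pow, one_mul]
    exact h.lintegral_comp hf

variable {Y : Type*} [MeasurableSpace Y] {ν : Measure Y} [SigmaFinite μ] [SigmaFinite ν]

theorem prod_left (h : IsIsometricWeight μ φ w) (ν : Measure Y) [SigmaFinite ν] :
    IsIsometricWeight (μ.prod ν) (fun q => (φ q.1, q.2)) (fun q => w q.1) where
  measurable_map := (h.measurable_map.comp measurable_fst).prodMk measurable_snd
  measurable_weight := h.measurable_weight.comp measurable_fst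
  weight_ne_zero q := h.weight_ne_zero q.1
  lintegral_eq f hf := by
    have := h.measurable_map
    have := h.measurable_weight
    rw [lintegral_prod_symm _ (by fun_prop), lintegral_prod_symm _ hf.aemeasurable]
    exact lintegral_congr fun y => h.lintegral_eq (fun x => f (x, y)) (by fun_prop)

theorem prod_right {ψ : Y → Y} {v : Y → ℂ} (h : IsIsometricWeight ν ψ v) (μ : Measure X)
    [SigmaFinite μ] :
    IsIsometricWeight (μ.prod ν) (fun q => (q.1, ψ q.2)) (fun q => v q.2) where
  measurable_map := measurable_fst.prodMk (h.measurable_map.comp measurable_snd)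
  measurable_weight := h.measurable_weight.comp measurable_snd
  weight_ne_zero q := h.weight_ne_zero q.2
  lintegral_eq f hf := by
    have := h.measurable_map
    have := h.measurable_weight
    rw [lintegral_prod _ (by fun_prop), lintegral_prod _ hf.aemeasurable]
    exact lintegral_congr fun x => h.lintegral_eq (fun y => f (x, y)) (by fun_prop)

theorem toIsometry_prod_left_lpMul (h : IsIsometricWeight μ φ w) (f : Lp ℂ 2 μ) (g : Lp ℂ 2 ν) :
    (h.prod_left ν).toIsometry (lpMul μ ν f g) = lpMul μ ν (h.toIsometry f) g := by
  apply Lp.ext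
  filter_upwards [(h.prod_left ν).coeFn_toIsometry (lpMul μ ν f g), coeFn_lpMul (h.toIsometry f) g,
    (h.prod_left ν).quasiMeasurePreserving.ae_eq_comp (coeFn_lpMul f g),
    Measure.quasiMeasurePreserving_fst.ae_eq_comp (h.coeFn_toIsometry f)] with q h1 h2 h3 h4
  simp only [Function.comp_apply] at h3 h4
  rw [h1, h2, h3, h4, mul_assoc]

theorem toIsometry_prod_right_lpMul {ψ : Y → Y} {v : Y → ℂ} (h : IsIsometricWeight ν ψ v)
    (f : Lp ℂ 2 μ) (g : Lp ℂ 2 ν) :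
    (h.prod_right μ).toIsometry (lpMul μ ν f g) = lpMul μ ν f (h.toIsometry g) := by
  apply Lp.ext
  filter_upwards [(h.prod_right μ).coeFn_toIsometry (lpMul μ ν f g),
    coeFn_lpMul f (h.toIsometry g),
    (h.prod_right μ).quasiMeasurePreserving.ae_eq_comp (coeFn_lpMul f g),
    Measure.quasiMeasurePreserving_snd.ae_eq_comp (h.coeFn_toIsometry g)] with q h1 h2 h3 h4
  simp only [Function.comp_apply] at h3 h4
  rw [h1, h2, h3, h4, mul_left_comm]

end IsIsometricWeight

/-! ### Hilbert space operators read as weighted composition operators. -/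

section Representation

variable {K L : Type*} [NormedAddCommGroup K] [InnerProductSpace ℂ K] [NormedAddCommGroup L]
  [InnerProductSpace ℂ L] {X Y : Type*} [MeasurableSpace X] {μ : Measure X}
  [MeasurableSpace Y] {ν : Measure Y}

/-- Under the identification `E` of the Hilbert space with `L²(μ)`, the operator `T` becomes
`f ↦ w · (f ∘ φ)`. -/
def ActsAs (E : K ≃ₗᵢ[ℂ] Lp ℂ 2 μ) (T : K →L[ℂ] K) (φ : X → X) (w : X → ℂ) : Prop :=
  ∃ h : IsIsometricWeight μ φ w, ∀ Ξ, E (T Ξ) = h.toIsometry (E Ξ)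

namespace ActsAs

variable {E : K ≃ₗᵢ[ℂ] Lp ℂ 2 μ} {S T : K →L[ℂ] K} {φ φ' ψ : X → X} {w w' : X → ℂ}

theorem mul (hS : ActsAs E S φ w) (hT : ActsAs E T φ' w') :
    ActsAs E (S * T) (fun x => φ' (φ x)) (fun x => w x * w' (φ x)) := by
  obtain ⟨h, hS⟩ := hS
  obtain ⟨h', hT⟩ := hT
  refine ⟨h.comp h', fun Ξ => ?_⟩
  rw [mul_apply_eq_comp, hS, hT, IsIsometricWeight.toIsometry_toIsometry]

theorem congr (hT : ActsAs E T φ w) (hφ : ∀ x, φ x = φ' x) (hw : ∀ x, w x = w' x) :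
    ActsAs E T φ' w' := by
  obtain rfl : φ = φ' := funext hφ
  obtain rfl : w = w' := funext hw
  exact hT

/-- This reduces the pentagon relations to pointwise algebra: equal point maps and equal weights
give equal operators. -/
theorem eq (hS : ActsAs E S φ w) (hT : ActsAs E T φ' w') (hφ : ∀ x, φ x = φ' x)
    (hw : ∀ x, w x = w' x) : S = T := by
  obtain ⟨h, hS⟩ := hS
  obtain ⟨h', hT⟩ := hT
  ext Ξ
  apply E.injective
  rw [hS, hT]
  exact h.toIsometry_congr h' hφ hw _

theorem eq_one (hT : ActsAs E T φ w) (hφ : ∀ x, φ x = x) (hw : ∀ x, w x = 1) : T = 1 := by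
  obtain ⟨h, hT⟩ := hT
  ext Ξ
  apply E.injective
  rw [hT, h.toIsometry_eq_self hφ hw]
  rfl

theorem mem_unitary [CompleteSpace K] (hT : ActsAs E T φ w) (hψ : Measurable ψ)
    (hψφ : ∀ x, ψ (φ x) = x) : T ∈ unitary (K →L[ℂ] K) := by
  obtain ⟨h, hT⟩ := hT
  let e := (E.trans (LinearIsometryEquiv.ofSurjective h.toIsometry
    (h.surjective_toIsometry hψ hψφ))).trans E.symm
  have : T = Unitary.linearIsometryEquiv.symm e := by
    ext Ξ
    apply E.injective
    rw [hT, Unitary.coe_symm_linearIsometryEquiv_apply]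
    simp [e]
  rw [this]
  exact (Unitary.linearIsometryEquiv.symm e).2

/-- A change of variables `e` conjugates the point map and pulls back the weight. It is needed for
`leg23`, which is defined through the associativity unitary. -/
theorem transport {EL : L ≃ₗᵢ[ℂ] Lp ℂ 2 ν} {T : L →L[ℂ] L} {ψ : Y → Y} {v : Y → ℂ}
    (hT : ActsAs EL T ψ v) (A : K ≃ₗᵢ[ℂ] L) (e : X ≃ᵐ Y) (he : MeasurePreserving e μ ν)
    (hA : ∀ Ξ, E Ξ =ᵐ[μ] fun x => EL (A Ξ) (e x)) {S : K →L[ℂ] K}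
    (hS : ∀ Ξ, A (S Ξ) = T (A Ξ)) :
    ActsAs E S (fun x => e.symm (ψ (e x))) (fun x => v (e x)) := by
  obtain ⟨h, hT⟩ := hT
  have hw : IsIsometricWeight μ (fun x => e.symm (ψ (e x))) (fun x => v (e x)) :=
    { measurable_map := e.symm.measurable.comp (h.measurable_map.comp e.measurable)
      measurable_weight := h.measurable_weight.comp e.measurable
      weight_ne_zero := fun x => h.weight_ne_zero _
      lintegral_eq := fun f hf => by
        have hf' : Measurable fun y => f (e.symm y) := hf.comp e.symm.measurable
        have hm : Measurable fun y => ‖v y‖ₑ ^ 2 * f (e.symm (ψ y)) :=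
          (h.measurable_weight.enorm.pow_const 2).mul (hf'.comp h.measurable_map)
        rw [he.lintegral_comp hm, h.lintegral_eq _ hf', ← he.lintegral_comp hf']
        simp }
  refine ⟨hw, fun Ξ => ?_⟩
  apply Lp.ext
  have h3 := hT (A Ξ)
  filter_upwards [hA (S Ξ), hw.coeFn_toIsometry (E Ξ),
    hw.quasiMeasurePreserving.ae_eq_comp (hA Ξ),
    he.quasiMeasurePreserving.ae_eq_comp (h.coeFn_toIsometry (EL (A Ξ)))] with x h1 h2 h4 h5
  simp only [Function.comp_apply, MeasurableEquiv.apply_symm_apply] at h4 h5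
  rw [h1, h2, h4, hS, h3, h5]

variable [SigmaFinite μ] [SigmaFinite ν]

theorem tensorOp_left {EL : L ≃ₗᵢ[ℂ] Lp ℂ 2 ν} (hT : ActsAs E T φ w)
    {F : HilbertTensor K L ≃ₗᵢ[ℂ] Lp ℂ 2 (μ.prod ν)}
    (hF : ∀ a b, F (tensorIncl K L (a ⊗ₜ b)) = lpMul μ ν (E a) (EL b)) :
    ActsAs F (tensorOp T 1) (fun q => (φ q.1, q.2)) (fun q => w q.1) := by
  obtain ⟨h, hT⟩ := hT
  refine ⟨h.prod_left ν, fun Ξ => ?_⟩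
  have : F.toLinearIsometry.toContinuousLinearMap ∘L tensorOp T 1 =
      (h.prod_left ν).toIsometry.toContinuousLinearMap ∘L F.toLinearIsometry.toContinuousLinearMap :=
    hilbertTensor_ext fun a b => by
      simp [tensorOp_tmul, hF, hT, h.toIsometry_prod_left_lpMul]
  exact DFunLike.congr_fun this Ξ

theorem tensorOp_right {EL : L ≃ₗᵢ[ℂ] Lp ℂ 2 ν} {T : L →L[ℂ] L} {ψ : Y → Y} {v : Y → ℂ}
    (hT : ActsAs EL T ψ v) {F : HilbertTensor K L ≃ₗᵢ[ℂ] Lp ℂ 2 (μ.prod ν)}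
    (hF : ∀ a b, F (tensorIncl K L (a ⊗ₜ b)) = lpMul μ ν (E a) (EL b)) :
    ActsAs F (tensorOp 1 T) (fun q => (q.1, ψ q.2)) (fun q => v q.2) := by
  obtain ⟨h, hT⟩ := hT
  refine ⟨h.prod_right μ, fun Ξ => ?_⟩
  have : F.toLinearIsometry.toContinuousLinearMap ∘L tensorOp 1 T =
      (h.prod_right μ).toIsometry.toContinuousLinearMap ∘L F.toLinearIsometry.toContinuousLinearMap :=
    hilbertTensor_ext fun a b => by
      simp [tensorOp_tmul, hF, hT, h.toIsometry_prod_right_lpMul]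
  exact DFunLike.congr_fun this Ξ

end ActsAs

variable [SigmaFinite μ] [SigmaFinite ν]

/-- The identification of `K ⊗ L` with `L²(μ × ν)` given by identifications of `K` with `L²(μ)`
and of `L` with `L²(ν)`. -/
noncomputable def tensorLpEquiv (E : K ≃ₗᵢ[ℂ] Lp ℂ 2 μ) (F : L ≃ₗᵢ[ℂ] Lp ℂ 2 ν) :
    HilbertTensor K L ≃ₗᵢ[ℂ] Lp ℂ 2 (μ.prod ν) :=
  (TensorProduct.congrIsometry E F).toLinearEquiv.extendOfIsometry
    (tensorIncl _ _).toLinearMap (lpTensorIncl μ ν).toLinearMap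
    (denseRange_tensorIncl _ _) (denseRange_lpTensorIncl μ ν)
    (fun x => ((lpTensorIncl μ ν).norm_map _).trans
      (((TensorProduct.congrIsometry E F).norm_map x).trans ((tensorIncl _ _).norm_map x).symm))

theorem tensorLpEquiv_tmul (E : K ≃ₗᵢ[ℂ] Lp ℂ 2 μ) (F : L ≃ₗᵢ[ℂ] Lp ℂ 2 ν) (a : K) (b : L) :
    tensorLpEquiv E F (tensorIncl _ _ (a ⊗ₜ b)) = lpMul μ ν (E a) (F b) :=
  LinearEquiv.extendOfIsometry_eq _ _ _ _ _ _ (a ⊗ₜ b)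

variable (μ) in
/-- The identification of `(L²(μ) ⊗ L²(μ)) ⊗ L²(μ)` with `L²((μ × μ) × μ)`. -/
noncomputable def lpTripleEquiv :
    HilbertTensor (HilbertTensor (Lp ℂ 2 μ) (Lp ℂ 2 μ)) (Lp ℂ 2 μ) ≃ₗᵢ[ℂ]
      Lp ℂ 2 ((μ.prod μ).prod μ) :=
  tensorLpEquiv (lpTensorEquiv μ μ) (LinearIsometryEquiv.refl ℂ _)

theorem actsAs_flipOp : ActsAs (lpTensorEquiv μ μ) (flipOp _ _) Prod.swap (fun _ => 1) := by
  have h := IsIsometricWeight.of_measurePreserving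
    (Measure.measurePreserving_swap (μ := μ) (ν := μ))
  refine ⟨h, fun Ξ => ?_⟩
  have : (lpTensorEquiv μ μ).toLinearIsometry.toContinuousLinearMap ∘L flipOp _ _ =
      h.toIsometry.toContinuousLinearMap ∘L (lpTensorEquiv μ μ).toLinearIsometry.toContinuousLinearMap :=
    hilbertTensor_ext fun a b => by
      simp only [ContinuousLinearMap.comp_apply, flipOp_tmul]
      change lpTensorEquiv μ μ _ = h.toIsometry (lpTensorEquiv μ μ _)
      rw [lpTensorEquiv_tmul, lpTensorEquiv_tmul]
      apply Lp.ext
      filter_upwards [coeFn_lpMul b a, h.coeFn_toIsometry (lpMul μ μ a b),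
        h.quasiMeasurePreserving.ae_eq_comp (coeFn_lpMul a b)] with q h1 h2 h3
      simp only [Function.comp_apply] at h3
      rw [h1, h2, h3, one_mul, mul_comm]
      rfl
  exact DFunLike.congr_fun this Ξ

/-- In terms of functions, the associativity unitary only rebrackets the variables. Both sides are
continuous in `Ξ`, so elementary tensors decide. -/
theorem lpTripleEquiv_ae_eq (Ξ : HilbertTensor (HilbertTensor (Lp ℂ 2 μ) (Lp ℂ 2 μ)) (Lp ℂ 2 μ)) :
    lpTripleEquiv μ Ξ =ᵐ[(μ.prod μ).prod μ] fun x =>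
      tensorLpEquiv (LinearIsometryEquiv.refl ℂ _) (lpTensorEquiv μ μ) (assocOp _ _ _ Ξ)
        (MeasurableEquiv.prodAssoc x) := by
  have he := measurePreserving_prodAssoc μ μ μ
  have : (lpTripleEquiv μ).toLinearIsometry.toContinuousLinearMap =
      (Lp.compMeasurePreservingₗᵢ ℂ _ he).toContinuousLinearMap ∘L
        (tensorLpEquiv (LinearIsometryEquiv.refl ℂ _)
          (lpTensorEquiv μ μ)).toLinearIsometry.toContinuousLinearMap ∘L
        (assocOp _ _ _).toLinearIsometry.toContinuousLinearMap := by
    refine hilbertTensor_ext_left fun a b c => ?_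
    simp only [ContinuousLinearMap.comp_apply, LinearIsometry.coe_toContinuousLinearMap,
      LinearIsometryEquiv.coe_toLinearIsometry, assocOp_tmul, tensorLpEquiv_tmul, lpTripleEquiv,
      lpTensorEquiv_tmul, LinearIsometryEquiv.coe_refl, id_eq]
    apply Lp.ext
    filter_upwards [coeFn_lpMul (lpMul μ μ a b) c,
      Measure.quasiMeasurePreserving_fst.ae_eq_comp (coeFn_lpMul a b),
      Lp.coeFn_compMeasurePreserving (lpMul μ (μ.prod μ) a (lpMul μ μ b c)) he,
      he.quasiMeasurePreserving.ae_eq_comp (coeFn_lpMul a (lpMul μ μ b c)),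
      (Measure.quasiMeasurePreserving_snd.comp he.quasiMeasurePreserving).ae_eq_comp
        (coeFn_lpMul b c)] with x h1 h2 h3 h4 h5
    simp only [Function.comp_apply] at h2 h3 h4 h5
    refine Eq.trans ?_ h3.symm
    rw [h1, h2, h4, h5, mul_assoc]
    rfl
  have h2 : lpTripleEquiv μ Ξ = Lp.compMeasurePreserving _ he
      (tensorLpEquiv (LinearIsometryEquiv.refl ℂ _) (lpTensorEquiv μ μ) (assocOp _ _ _ Ξ)) :=
    DFunLike.congr_fun this Ξ
  rw [h2]
  exact Lp.coeFn_compMeasurePreserving _ he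

variable {V : HilbertTensor (Lp ℂ 2 μ) (Lp ℂ 2 μ) →L[ℂ] HilbertTensor (Lp ℂ 2 μ) (Lp ℂ 2 μ)}
  {φ : X × X → X × X} {w : X × X → ℂ}

theorem ActsAs.leg12 (h : ActsAs (lpTensorEquiv μ μ) V φ w) :
    ActsAs (lpTripleEquiv μ) (leg12 V) (fun q => (φ q.1, q.2)) (fun q => w q.1) :=
  h.tensorOp_left (tensorLpEquiv_tmul _ _)

theorem ActsAs.leg23 (h : ActsAs (lpTensorEquiv μ μ) V φ w) :
    ActsAs (lpTripleEquiv μ) (leg23 V)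
      (fun q => ((q.1.1, (φ (q.1.2, q.2)).1), (φ (q.1.2, q.2)).2)) (fun q => w (q.1.2, q.2)) :=
  (h.tensorOp_right (tensorLpEquiv_tmul (LinearIsometryEquiv.refl ℂ (Lp ℂ 2 μ)) _)).transport
    (assocOp _ _ _) MeasurableEquiv.prodAssoc (measurePreserving_prodAssoc μ μ μ)
    lpTripleEquiv_ae_eq (fun Ξ => by simp [_root_.leg23]; rfl)

theorem ActsAs.leg13 (h : ActsAs (lpTensorEquiv μ μ) V φ w) :
    ActsAs (lpTripleEquiv μ) (leg13 V)
      (fun q => (((φ (q.1.1, q.2)).1, q.1.2), (φ (q.1.1, q.2)).2)) (fun q => w (q.1.1, q.2)) := by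
  rw [leg13_eq]
  refine ((actsAs_flipOp.leg23.mul h.leg12).mul actsAs_flipOp.leg23).congr (fun q => rfl)
    fun q => ?_
  simp

theorem ActsAs.hatOp {u : Lp ℂ 2 μ →L[ℂ] Lp ℂ 2 μ} {σ : X → X} {v : X → ℂ}
    (h : ActsAs (lpTensorEquiv μ μ) V φ w)
    (hu : ActsAs (LinearIsometryEquiv.refl ℂ (Lp ℂ 2 μ)) u σ v) :
    ActsAs (lpTensorEquiv μ μ) (hatOp u V)
      (fun q => ((φ (σ q.2, q.1)).2, σ (φ (σ q.2, q.1)).1))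
      (fun q => v q.2 * w (σ q.2, q.1) * v (φ (σ q.2, q.1)).1) := by
  have hu1 := hu.tensorOp_left (F := lpTensorEquiv μ μ) (EL := LinearIsometryEquiv.refl ℂ _)
    (lpTensorEquiv_tmul μ μ)
  refine ((((actsAs_flipOp.mul hu1).mul h).mul hu1).mul actsAs_flipOp).congr (fun q => rfl)
    fun q => ?_
  simp

end Representation

/-! ### The operators of the quantum Heisenberg group -/

section QuantumHeisenbergKac

theorem eBar_add (s t : ℝ) : eBar (s + t) = eBar s * eBar t := by
  rw [eBar, eBar, eBar, ← Complex.exp_add]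
  congr 1
  push_cast
  ring

theorem eBar_zero : eBar 0 = 1 := by simp [eBar]

theorem conj_eBar (t : ℝ) : conj (eBar t) = eBar (-t) := by
  rw [eBar, eBar, ← Complex.exp_conj]
  congr 1
  simp [Complex.conj_ofNat]

/-- The cocycle identity. Together with `η(0) = 0` it is all the algebra of `η` that the operator
identities require. -/
theorem heisEta_add (lam r s : ℝ) :
    heisEta lam (r + s) = heisEta lam r + Real.exp (lam * r) ^ 2 * heisEta lam s := by
  unfold heisEta
  split_ifs with h
  · simp [h]
  · have h1 : Real.exp (2 * lam * (r + s)) = Real.exp (lam * r) ^ 2 * Real.exp (2 * lam * s) := by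
      rw [← Real.exp_nat_mul, ← Real.exp_add]
      congr 1
      push_cast
      ring
    have h2 : Real.exp (2 * lam * r) = Real.exp (lam * r) ^ 2 := by
      rw [← Real.exp_nat_mul]
      congr 1
      push_cast
      ring
    rw [h1, h2]
    field_simp
    ring

theorem heisEta_zero (lam : ℝ) : heisEta lam 0 = 0 := by simp [heisEta]

theorem heisEta_neg (lam r : ℝ) :
    Real.exp (lam * r) ^ 2 * heisEta lam (-r) = -heisEta lam r := by
  have := heisEta_add lam r (-r)
  rw [add_neg_cancel, heisEta_zero] at this
  linarith

variable {n : ℕ}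

section Beta

variable (x x' y y' : EuclideanSpace ℝ (Fin n)) (c : ℝ)

theorem heisBeta_smul_left : heisBeta (c • x) y = c * heisBeta x y := by
  simp [heisBeta, inner_smul_left]

theorem heisBeta_smul_right : heisBeta x (c • y) = c * heisBeta x y := by
  simp [heisBeta, inner_smul_right]

theorem heisBeta_add_left : heisBeta (x + x') y = heisBeta x y + heisBeta x' y :=
  inner_add_left _ _ _

theorem heisBeta_add_right : heisBeta x (y + y') = heisBeta x y + heisBeta x y' :=
  inner_add_right _ _ _

theorem heisBeta_sub_left : heisBeta (x - x') y = heisBeta x y - heisBeta x' y :=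
  inner_sub_left _ _ _

theorem heisBeta_sub_right : heisBeta x (y - y') = heisBeta x y - heisBeta x y' :=
  inner_sub_right _ _ _

end Beta

/-- The weight `cⁿ ē(t)`. -/
noncomputable def dilationPhase (n : ℕ) (c t : ℝ) : ℂ := (c ^ n : ℝ) * eBar t

/-- Equality of two weights thus splits into an identity of dilation factors and an identity of real
phases. -/
theorem dilationPhase_mul (c d s t : ℝ) :
    dilationPhase n c s * dilationPhase n d t = dilationPhase n (c * d) (s + t) := by
  rw [dilationPhase, dilationPhase, dilationPhase, mul_pow, eBar_add]
  push_cast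
  ring

theorem dilationPhase_one_zero : dilationPhase n 1 0 = 1 := by simp [dilationPhase, eBar_zero]

variable (n) (lam : ℝ)

theorem actsAs_heisj :
    ActsAs (LinearIsometryEquiv.refl ℂ (HeisSpace n)) (heisj n lam)
      (fun p => (-(Real.exp (lam * p.2)) • p.1, -p.2))
      (fun p => dilationPhase n (Real.exp (lam * p.2)) (heisEta lam p.2 * heisBeta p.1.1 p.1.2)) :=
  ⟨isIsometricWeight_heisj n lam, fun _ => rfl⟩

theorem actsAs_heisU :
    ActsAs (lpTensorEquiv volume volume) (heisU n lam)
      (fun q : HeisVar n × HeisVar n => ((Real.exp (-(lam * q.2.2)) • q.1.1, q.1.2 + q.2.2),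
        (q.2.1 - Real.exp (-(lam * q.2.2)) • q.1.1, q.2.2)))
      (fun q => dilationPhase n (Real.exp (-(lam * q.2.2)))
        (heisEta lam q.2.2 * heisBeta (Real.exp (-(lam * q.2.2)) • q.1.1.1)
          (q.2.1.2 - Real.exp (-(lam * q.2.2)) • q.1.1.2))) :=
  ⟨isIsometricWeight_heisU n lam, fun Ξ => by
    simp only [heisU, ContinuousLinearMap.comp_apply]
    exact LinearIsometryEquiv.apply_symm_apply _ _⟩

theorem heisj_mul_self : heisj n lam * heisj n lam = 1 := by
  refine ((actsAs_heisj n lam).mul (actsAs_heisj n lam)).eq_one ?_ ?_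
  · rintro ⟨v, r⟩
    simp only [neg_smul, smul_neg, smul_smul, neg_neg, neg_mul, mul_neg, ← Real.exp_add, neg_add_cancel,
      Real.exp_zero, one_smul]
  · rintro ⟨⟨x, y⟩, r⟩
    simp only [Prod.smul_mk, dilationPhase_mul, heisBeta_smul_left, heisBeta_smul_right]
    rw [← dilationPhase_one_zero (n := n), mul_neg, ← Real.exp_add, add_neg_cancel, Real.exp_zero]
    congr 1
    linear_combination heisBeta x y * heisEta_neg lam r

theorem heisj_mem_unitary : heisj n lam ∈ unitary (HeisSpace n →L[ℂ] HeisSpace n) := by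
  refine (actsAs_heisj n lam).mem_unitary (ψ := heisjMap lam)
    (isIsometricWeight_heisj n lam).measurable_map ?_
  rintro ⟨v, r⟩
  simp only [heisjMap, neg_smul, smul_neg, smul_smul, neg_neg, neg_mul, mul_neg, ← Real.exp_add,
    neg_add_cancel, Real.exp_zero, one_smul]

theorem star_heisj : star (heisj n lam) = heisj n lam := by
  have h1 := Unitary.star_mul_self_of_mem (heisj_mem_unitary n lam)
  calc star (heisj n lam) = star (heisj n lam) * (heisj n lam * heisj n lam) := by
        rw [heisj_mul_self, mul_one]
    _ = heisj n lam := by rw [← mul_assoc, h1, one_mul]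

theorem heisU_mem_unitary : heisU n lam ∈ unitary
    (HilbertTensor (HeisSpace n) (HeisSpace n) →L[ℂ] HilbertTensor (HeisSpace n) (HeisSpace n)) := by
  -- `U_A` fixes `r'`, so its point map is inverted by first restoring `(x', y')` by adding the
  -- already dilated `(x, y)`, then undoing the dilation and the shift of `r`.
  refine (actsAs_heisU n lam).mem_unitary (ψ := fun q =>
    ((Real.exp (lam * q.2.2) • q.1.1, q.1.2 - q.2.2), (q.2.1 + q.1.1, q.2.2))) (by fun_prop) ?_
  rintro ⟨⟨v, r⟩, ⟨v', r'⟩⟩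
  simp only [smul_smul, ← Real.exp_add]
  simp

theorem pentagon_heisU : Pentagon (heisU n lam) := by
  have h := actsAs_heisU n lam
  refine ((h.leg12.mul h.leg13).mul h.leg23).eq (h.leg23.mul h.leg12) ?_ ?_
  all_goals
    rintro ⟨⟨⟨v₁, r₁⟩, ⟨v₂, r₂⟩⟩, ⟨v₃, r₃⟩⟩
    have he : Real.exp (-(lam * (r₂ + r₃))) = Real.exp (-(lam * r₂)) * Real.exp (-(lam * r₃)) := by
      rw [← Real.exp_add]
      congr 1
      ring
    dsimp only
    rw [he]
  · refine Prod.ext (Prod.ext (Prod.ext ?_ ?_) (Prod.ext ?_ ?_)) (Prod.ext ?_ ?_) <;> dsimp only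
    · module
    · ring
    · module
    · module
  · have hη := heisEta_add lam r₃ r₂
    have hc : Real.exp (lam * r₃) * Real.exp (-(lam * r₃)) = 1 := by
      rw [← Real.exp_add, add_neg_cancel, Real.exp_zero]
    rw [add_comm r₃ r₂] at hη
    obtain ⟨x₁, y₁⟩ := v₁
    obtain ⟨x₂, y₂⟩ := v₂
    obtain ⟨x₃, y₃⟩ := v₃
    simp only [Prod.fst_sub, Prod.snd_sub, Prod.smul_fst, Prod.smul_snd, dilationPhase_mul,
      heisBeta_smul_left, heisBeta_smul_right, heisBeta_sub_left, heisBeta_sub_right, hη]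
    generalize Real.exp (-(lam * r₃)) = c at *
    generalize Real.exp (-(lam * r₂)) = d at *
    generalize Real.exp (lam * r₃) = e at *
    congr 1
    · ring
    -- The factor `e^{2λr₃}` from expanding `η(r₂ + r₃)` cancels against the dilations by `e^{-λr₃}`
    -- in both arguments of `β`.
    · have hc2 : e ^ 2 * c ^ 2 = 1 := by rw [← mul_pow, hc, one_pow]
      linear_combination (-heisEta lam r₂ * d * (heisBeta x₁ y₂ - d * heisBeta x₁ y₁)) * hc2

/-- The dilation factors of `U_A` and of the two copies of `j` multiply to 1, so only a phase is
left. The second pentagon computation starts from this closed form. -/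
theorem actsAs_hatOp_heisU :
    ActsAs (lpTensorEquiv volume volume) (hatOp (heisj n lam) (heisU n lam))
      (fun q : HeisVar n × HeisVar n =>
        ((q.1.1 + Real.exp (lam * (q.2.2 - q.1.2)) • q.2.1, q.1.2), (q.2.1, q.2.2 - q.1.2)))
      (fun q => eBar (-(Real.exp (lam * (q.2.2 - q.1.2)) * heisEta lam q.1.2 *
        heisBeta q.2.1.1 q.1.1.2))) := by
  refine ((actsAs_heisU n lam).hatOp (actsAs_heisj n lam)).congr ?_ ?_
  all_goals
    rintro ⟨⟨v, r⟩, ⟨v', r'⟩⟩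
    have he : Real.exp (lam * (r' - r)) = Real.exp (lam * r') * Real.exp (-(lam * r)) := by
      rw [← Real.exp_add]
      congr 1
      ring
    have he' : Real.exp (lam * (-r' + r)) * (Real.exp (lam * r') * Real.exp (-(lam * r))) = 1 := by
      rw [← Real.exp_add, ← Real.exp_add, ← Real.exp_zero]
      congr 1
      ring
    dsimp only
    rw [he]
  · refine Prod.ext (Prod.ext ?_ ?_) (Prod.ext ?_ ?_) <;> dsimp only
    · module
    · rw [smul_smul, smul_smul]
      convert one_smul ℝ v' using 2
      linear_combination he'
    · ring
  · have hη := heisEta_add lam (-r' + r) r'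
    have hη' := heisEta_neg lam r'
    have hc : Real.exp (lam * r') * Real.exp (-(lam * r')) = 1 := by
      rw [← Real.exp_add, add_neg_cancel, Real.exp_zero]
    obtain ⟨x, y⟩ := v
    obtain ⟨x', y'⟩ := v'
    have h1 : ∀ t, eBar t = dilationPhase n 1 t := fun t => by simp [dilationPhase]
    rw [h1]
    -- Splitting `r = (r - r') + r'` relates the value of `η` produced by the second `j` to those at
    -- `r` and `r'`.
    rw [show -r' + r + r' = r by ring] at hη
    simp only [Prod.smul_mk, dilationPhase_mul, heisBeta_smul_left, heisBeta_smul_right,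
      heisBeta_sub_right]
    generalize Real.exp (lam * (-r' + r)) = a at *
    generalize Real.exp (-(lam * r)) = c at *
    generalize Real.exp (lam * r') = d at *
    congr 1
    · linear_combination he'
    · rw [hη]
      have h2 : a ^ 2 * d ^ 2 * c ^ 2 = 1 := by
        rw [← mul_pow, ← mul_pow, mul_assoc, he', one_pow]
      linear_combination (-heisBeta x' y' * heisEta lam r') * h2

theorem pentagon_hatOp_heisU : Pentagon (hatOp (heisj n lam) (heisU n lam)) := by
  have h := actsAs_hatOp_heisU n lam
  refine ((h.leg12.mul h.leg13).mul h.leg23).eq (h.leg23.mul h.leg12) ?_ ?_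
  all_goals
    rintro ⟨⟨⟨v₁, r₁⟩, ⟨v₂, r₂⟩⟩, ⟨v₃, r₃⟩⟩
    have he : Real.exp (lam * (r₃ - r₁)) =
        Real.exp (lam * (r₃ - r₂)) * Real.exp (lam * (r₂ - r₁)) := by
      rw [← Real.exp_add]
      congr 1
      ring
    have hr : r₃ - r₁ - (r₂ - r₁) = r₃ - r₂ := by ring
    dsimp only
    rw [hr, he]
  · refine Prod.ext (Prod.ext (Prod.ext ?_ ?_) (Prod.ext ?_ ?_)) (Prod.ext ?_ ?_)
    all_goals dsimp only
    module
  -- Writing `r₂ = (r₂ - r₁) + r₁` expresses all phases through `η(r₁)` and `η(r₂ - r₁)`.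
  · have hη := heisEta_add lam (r₂ - r₁) r₁
    rw [sub_add_cancel] at hη
    obtain ⟨x₁, y₁⟩ := v₁
    obtain ⟨x₂, y₂⟩ := v₂
    obtain ⟨x₃, y₃⟩ := v₃
    simp only [Prod.fst_add, Prod.snd_add, Prod.smul_fst, Prod.smul_snd, ← eBar_add,
      heisBeta_smul_left, heisBeta_smul_right, heisBeta_add_left, heisBeta_add_right, hη]
    congr 1
    ring

/-- One factor is put in closed form before cubing. On the last coordinates its point map is `(r,
r') ↦ (r' - r, -r)`, which has order three. -/
theorem flip_mul_heisj_mul_heisU_pow_three :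
    (flipOp (HeisSpace n) (HeisSpace n) * tensorOp 1 (heisj n lam) * heisU n lam) ^ 3 = 1 := by
  have hj := (actsAs_heisj n lam).tensorOp_right
    (E := LinearIsometryEquiv.refl ℂ (HeisSpace n)) (F := lpTensorEquiv volume volume)
    (lpTensorEquiv_tmul volume volume)
  have h : ActsAs (lpTensorEquiv volume volume)
      (flipOp (HeisSpace n) (HeisSpace n) * tensorOp 1 (heisj n lam) * heisU n lam)
      (fun q => ((Real.exp (lam * q.1.2) • q.2.1, q.2.2 - q.1.2),
        (-Real.exp (lam * q.1.2) • (q.1.1 + q.2.1), -q.1.2)))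
      (fun q => dilationPhase n (Real.exp (lam * q.1.2) * Real.exp (lam * q.1.2))
        (heisEta lam q.1.2 *
          (heisBeta q.1.1.1 q.1.1.2 + heisBeta q.2.1.1 (q.1.1.2 + q.2.1.2)))) := by
    refine ((actsAs_flipOp.mul hj).mul (actsAs_heisU n lam)).congr ?_ ?_
    all_goals
      rintro ⟨⟨⟨x, y⟩, r⟩, ⟨⟨x', y'⟩, r'⟩⟩
      dsimp only [Prod.swap]
      rw [mul_neg, neg_neg]
    · refine Prod.ext (Prod.ext ?_ ?_) (Prod.ext ?_ ?_) <;> dsimp only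
      · ring
      · module
    · have hη := heisEta_neg lam r
      simp only [Prod.smul_mk, one_mul, dilationPhase_mul, heisBeta_smul_left,
        heisBeta_smul_right, heisBeta_sub_right, heisBeta_add_right]
      congr 1
      linear_combination (-heisBeta x' y - heisBeta x' y') * hη
  rw [pow_succ, pow_two]
  refine ((h.mul h).mul h).eq_one ?_ ?_
  all_goals
    rintro ⟨⟨⟨x, y⟩, r⟩, ⟨⟨x', y'⟩, r'⟩⟩
    have h1 : Real.exp (lam * (-r - (r' - r))) = (Real.exp (lam * r'))⁻¹ := by
      rw [← Real.exp_neg]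
      congr 1
      ring
    have h2 : Real.exp (lam * (r' - r)) = Real.exp (lam * r') * (Real.exp (lam * r))⁻¹ := by
      rw [← Real.exp_neg, ← Real.exp_add]
      congr 1
      ring
    have h3 : Real.exp (lam * r) ≠ 0 := Real.exp_ne_zero _
    have h4 : Real.exp (lam * r') ≠ 0 := Real.exp_ne_zero _
    dsimp only
    rw [h1, h2]
  · generalize Real.exp (lam * r) = c at *
    generalize Real.exp (lam * r') = d at *
    refine Prod.ext (Prod.ext ?_ ?_) (Prod.ext ?_ ?_) <;> dsimp only
    · match_scalars <;> field_simp
      ring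
    · ring
    · match_scalars <;> field_simp <;> ring
    · ring
  -- The three factors evaluate `η` at `r`, `r' - r` and `-r'`. The cocycle identity gives one
  -- linear relation between these values, and the total phase is a multiple of it.
  · have hη := heisEta_add lam r (r' - r)
    have hη' := heisEta_neg lam r'
    rw [add_sub_cancel] at hη
    rw [show -r - (r' - r) = -r' by ring]
    rw [hη] at hη'
    generalize Real.exp (lam * r) = c at *
    generalize Real.exp (lam * r') = d at *
    simp only [Prod.smul_mk, Prod.mk_add_mk, dilationPhase_mul, heisBeta_smul_left,
      heisBeta_smul_right, heisBeta_add_left, heisBeta_add_right]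
    rw [← dilationPhase_one_zero (n := n)]
    congr 1
    · field_simp
    · field_simp
      linear_combination (heisBeta x y + heisBeta x' y + heisBeta x' y') * hη'

/-! ### The partial transpose of `U_A`, as a shear with phase followed in the point map by a
dilation. -/

theorem isIsometricWeight_shear :
    IsIsometricWeight ((volume : Measure (HeisVar n)).prod (volume : Measure (HeisVar n)))
      (fun q => ((q.1.1 - q.2.1, q.1.2), q.2))
      (fun q => eBar (heisEta lam q.1.2 * heisBeta q.2.1.1 (q.1.1.2 - q.2.1.2))) where
  measurable_map := by fun_prop
  measurable_weight := by fun_prop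
  weight_ne_zero q := eBar_ne_zero _
  lintegral_eq f hf := by
    simp only [enorm_eBar, one_pow, one_mul]
    have := isAddHaarMeasure_heisVar n
    rw [lintegral_prod_symm _ (by fun_prop), lintegral_prod_symm _ hf.aemeasurable]
    refine lintegral_congr fun q => ?_
    rw [← lintegral_sub_right_eq_self (fun p => f (p, q)) ((q.1, 0) : HeisVar n)]
    refine lintegral_congr fun p => ?_
    rw [show p - (q.1, 0) = (p.1 - q.1, p.2) by ext <;> simp]

theorem isIsometricWeight_dilation :
    IsIsometricWeight ((volume : Measure (HeisVar n)).prod (volume : Measure (HeisVar n)))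
      (fun q => (q.1, (Real.exp (lam * q.1.2) • q.2.1, q.2.2 - q.1.2)))
      (fun q => ((Real.exp (lam * q.1.2) ^ n : ℝ) : ℂ)) where
  measurable_map := by fun_prop
  measurable_weight := by fun_prop
  weight_ne_zero q := by simp
  lintegral_eq f hf := by
    simp only [enorm_exp_pow]
    rw [lintegral_prod _ (by fun_prop), lintegral_prod _ hf.aemeasurable]
    refine lintegral_congr fun p => ?_
    exact lintegral_dilation n (c := fun _ => Real.exp (lam * p.2)) (by fun_prop)
      (fun _ => Real.exp_ne_zero _) (measurePreserving_sub_right volume p.2)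
      (fun q => f (p, q)) (by fun_prop)

/-- In the integral for `⟪η ⊗ a, U_A(ξ ⊗ ζ)⟫`, variables are chosen so that `a` is evaluated at `(x,
y, r)` and `ξ` at `(x', y', r')`. Then `ζ` sits at `(x - x', y - y', r)` and `η` at `(e^{λr}x',
e^{λr}y', r' - r)`, which is an invertible weighted composition applied to `ζ ⊗ η̄`. -/
theorem hasUnitaryPartialTranspose_heisU : HasUnitaryPartialTranspose (heisU n lam) := by
  have hD := isIsometricWeight_dilation n lam
  have hW := (isIsometricWeight_shear n lam).comp hD
  have hG := hD.comp (IsIsometricWeight.of_measurePreserving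
    (Measure.measurePreserving_swap (μ := (volume : Measure (HeisVar n)))
      (ν := (volume : Measure (HeisVar n)))))
  obtain ⟨hU, hUE⟩ := actsAs_heisU n lam
  have hsurj : Function.Surjective hW.toIsometry := by
    refine hW.surjective_toIsometry (ψ := fun q =>
      ((q.1.1 + Real.exp (-(lam * q.1.2)) • q.2.1, q.1.2),
        (Real.exp (-(lam * q.1.2)) • q.2.1, q.2.2 + q.1.2))) (by fun_prop) ?_
    rintro ⟨⟨v, r⟩, ⟨v', r'⟩⟩
    simp only [smul_smul, ← Real.exp_add]
    simp
  refine ⟨LinearIsometryEquiv.ofSurjective hW.toIsometry hsurj, fun a η ξ ζ => ?_⟩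
  -- Applying the isometry `hG.toIsometry` to both entries of the inner product is the change of
  -- variables.
  rw [← (lpTensorEquiv volume volume).inner_map_map, hUE, lpTensorEquiv_tmul, lpTensorEquiv_tmul,
    ← hG.toIsometry.inner_map_map, LinearIsometryEquiv.coe_ofSurjective, L2.inner_def, L2.inner_def]
  refine integral_congr_ae ?_
  have hfst := Measure.quasiMeasurePreserving_fst (μ := (volume : Measure (HeisVar n)))
    (ν := (volume : Measure (HeisVar n)))
  have hsnd := Measure.quasiMeasurePreserving_snd (μ := (volume : Measure (HeisVar n)))
    (ν := (volume : Measure (HeisVar n)))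
  filter_upwards [hG.coeFn_toIsometry (lpMul volume volume η a),
    hG.quasiMeasurePreserving.ae_eq_comp (coeFn_lpMul η a),
    hG.coeFn_toIsometry (hU.toIsometry (lpMul volume volume ξ ζ)),
    hG.quasiMeasurePreserving.ae_eq_comp (hU.coeFn_toIsometry (lpMul volume volume ξ ζ)),
    (hU.quasiMeasurePreserving.comp hG.quasiMeasurePreserving).ae_eq_comp (coeFn_lpMul ξ ζ),
    coeFn_lpMul a (lpConj volume ξ), hsnd.ae_eq_comp (coeFn_lpConj ξ),
    hW.coeFn_toIsometry (lpMul volume volume ζ (lpConj volume η)),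
    hW.quasiMeasurePreserving.ae_eq_comp (coeFn_lpMul ζ (lpConj volume η)),
    (hsnd.comp hW.quasiMeasurePreserving).ae_eq_comp (coeFn_lpConj η)]
    with q h1 h2 h3 h4 h5 h6 h7 h8 h9 h10
  simp only [Function.comp_apply] at h2 h4 h5 h7 h9 h10
  rw [h1, h2, h3, h4, h5, h6, h7, h8, h9, h10]
  clear h1 h2 h3 h4 h5 h6 h7 h8 h9 h10
  obtain ⟨⟨⟨x, y⟩, r⟩, ⟨⟨x', y'⟩, r'⟩⟩ := q
  have hc : Real.exp (-(lam * r)) * Real.exp (lam * r) = 1 := by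
    rw [← Real.exp_add, neg_add_cancel, Real.exp_zero]
  have hcn : ((Real.exp (-(lam * r)) ^ n : ℝ) : ℂ) * ((Real.exp (lam * r) ^ n : ℝ) : ℂ) = 1 := by
    rw [← Complex.ofReal_mul, ← mul_pow, hc, one_pow, Complex.ofReal_one]
  simp only [Prod.swap, Prod.smul_mk, Prod.mk_sub_mk, smul_smul, hc, one_smul, sub_add_cancel,
    dilationPhase, RCLike.inner_apply, map_mul, Complex.conj_conj, Complex.conj_ofReal, mul_one]
  -- The change of variables contributes `e^{nλr}` twice and `U_A` contributes `e^{-nλr}`, while `W`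
  -- has a single `e^{nλr}`. Hence one use of `hcn`.
  linear_combination (eBar (heisEta lam r * heisBeta x' (y - y')) * ξ ((x', y'), r') *
    ζ ((x - x', y - y'), r) * conj (a ((x, y), r)) * ((Real.exp (lam * r) ^ n : ℝ) : ℂ) *
    conj (η ((Real.exp (lam * r) • x', Real.exp (lam * r) • y'), r' - r))) * hcn

theorem heisj_eq_heisJhat_heisJ (ξ : HeisSpace n) :
    heisj n lam ξ = heisJhat n lam (heisJ n lam ξ) := by
  apply Lp.ext
  filter_upwards [heisj_apply n lam ξ, heisJhat_apply n lam (heisJ n lam ξ),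
    (isIsometricWeight_heisJhat n lam).quasiMeasurePreserving.ae_eq_comp (heisJ_apply n lam ξ)]
    with p h1 h2 h3
  simp only [Function.comp_apply, heisJhatMap] at h3
  rw [h1, h2]
  refine Eq.trans ?_ (congrArg (fun z => _ * conj z) h3.symm)
  obtain ⟨⟨x, y⟩, r⟩ := p
  have hη := heisEta_neg lam r
  simp only [Prod.smul_mk, map_mul, conj_eBar, Complex.conj_conj, heisBeta_smul_left,
    heisBeta_smul_right, neg_smul, mul_assoc]
  congr 3
  -- `Ĵ` conjugates the phase of `J` and evaluates it at `-r` and dilated arguments, giving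
  -- `-e^{2λr} η(-r) = η(r)`. In the other order the phase of `J` is outermost and no such identity
  -- is needed.
  linear_combination heisBeta x y * hη

theorem heisj_eq_heisJ_heisJhat (ξ : HeisSpace n) :
    heisj n lam ξ = heisJ n lam (heisJhat n lam ξ) := by
  apply Lp.ext
  filter_upwards [heisj_apply n lam ξ, heisJ_apply n lam (heisJhat n lam ξ),
    (isIsometricWeight_heisJ n lam).quasiMeasurePreserving.ae_eq_comp (heisJhat_apply n lam ξ)]
    with p h1 h2 h3
  simp only [Function.comp_apply, heisJMap, neg_one_smul] at h3
  rw [h1, h2]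
  refine Eq.trans ?_ (congrArg (fun z => _ * conj z) h3.symm)
  obtain ⟨⟨x, y⟩, r⟩ := p
  simp only [Prod.neg_mk, map_mul, Complex.conj_conj, Complex.conj_ofReal, neg_smul, smul_neg]
  ring

/-- A unitary operator with the pentagon relation and a unitary partial transpose. -/
structure IsTransposableMultiplicativeUnitary {X : Type*} [MeasurableSpace X] {μ : Measure X}
    [SigmaFinite μ]
    (V : HilbertTensor (Lp ℂ 2 μ) (Lp ℂ 2 μ) →L[ℂ] HilbertTensor (Lp ℂ 2 μ) (Lp ℂ 2 μ)) :
    Prop where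
  isUnitary : V ∈ unitary
    (HilbertTensor (Lp ℂ 2 μ) (Lp ℂ 2 μ) →L[ℂ] HilbertTensor (Lp ℂ 2 μ) (Lp ℂ 2 μ))
  pentagon : Pentagon V
  transpose : HasUnitaryPartialTranspose V

namespace IsTransposableMultiplicativeUnitary

variable {X : Type*} [MeasurableSpace X] {μ : Measure X} [SigmaFinite μ]
  {V : HilbertTensor (Lp ℂ 2 μ) (Lp ℂ 2 μ) →L[ℂ] HilbertTensor (Lp ℂ 2 μ) (Lp ℂ 2 μ)}

theorem isRegular (h : IsTransposableMultiplicativeUnitary V) : IsRegularMultiplicativeUnitary V :=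
  ⟨h.isUnitary, h.pentagon, h.transpose.regular⟩

theorem flip_star (h : IsTransposableMultiplicativeUnitary V) :
    IsTransposableMultiplicativeUnitary (flipOp _ _ * star V * flipOp _ _) where
  isUnitary := mul_mem (mul_mem flipOp_mem_unitary (Unitary.star_mem h.isUnitary))
    flipOp_mem_unitary
  pentagon := h.pentagon.flip_inv (Unitary.mul_star_self_of_mem h.isUnitary)
    (Unitary.star_mul_self_of_mem h.isUnitary)
  transpose := h.transpose.flip_star

theorem tensorOp_conj (h : IsTransposableMultiplicativeUnitary V) {u : Lp ℂ 2 μ →L[ℂ] Lp ℂ 2 μ}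
    (hu : u ∈ unitary (Lp ℂ 2 μ →L[ℂ] Lp ℂ 2 μ)) (hsu : star u = u) (huu : u * u = 1) :
    IsTransposableMultiplicativeUnitary (tensorOp u u * V * tensorOp u u) where
  isUnitary := mul_mem (mul_mem (tensorOp_mem_unitary hu hu) h.isUnitary)
    (tensorOp_mem_unitary hu hu)
  pentagon := h.pentagon.conj huu
  transpose := by
    -- Conjugation by `u ⊗ u` is the hat applied twice, so its transpose comes from two uses of the
    -- hat case.
    rw [← hatOp_hatOp]
    exact (h.transpose.hatOp hu hsu).hatOp hu hsu

end IsTransposableMultiplicativeUnitary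

end QuantumHeisenbergKac

theorem mainTheorem11 (n : ℕ) (lam : ℝ) :
    -- `j = Ĵ J = J Ĵ`
    (∀ ξ : HeisSpace n, heisj n lam ξ = heisJhat n lam (heisJ n lam ξ) ∧
      heisj n lam ξ = heisJ n lam (heisJhat n lam ξ)) ∧
    -- applying the hat twice or the tilde twice gives `(j ⊗ j) U_A (j ⊗ j)`
    hatOp (heisj n lam) (hatOp (heisj n lam) (heisU n lam)) =
      tensorOp (heisj n lam) (heisj n lam) * heisU n lam *
        tensorOp (heisj n lam) (heisj n lam) ∧
    tildeOp (heisj n lam) (tildeOp (heisj n lam) (heisU n lam)) =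
      tensorOp (heisj n lam) (heisj n lam) * heisU n lam *
        tensorOp (heisj n lam) (heisj n lam) ∧
    -- the four operators `X` and the four operators `Σ X* Σ`
    (∀ X : HilbertTensor (HeisSpace n) (HeisSpace n) →L[ℂ]
          HilbertTensor (HeisSpace n) (HeisSpace n),
      (X = heisU n lam ∨ X = hatOp (heisj n lam) (heisU n lam) ∨
        X = tildeOp (heisj n lam) (heisU n lam) ∨
        X = tensorOp (heisj n lam) (heisj n lam) * heisU n lam *
          tensorOp (heisj n lam) (heisj n lam)) →
      IsRegularMultiplicativeUnitary X ∧
      IsRegularMultiplicativeUnitary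
        (flipOp (HeisSpace n) (HeisSpace n) * star X * flipOp (HeisSpace n) (HeisSpace n))) ∧
    -- the Kac system
    IsKacSystem (heisU n lam) (heisj n lam) := by
  have hu := heisj_mem_unitary n lam
  have hsu := star_heisj n lam
  have huu := heisj_mul_self n lam
  have hU : IsTransposableMultiplicativeUnitary (heisU n lam) :=
    ⟨heisU_mem_unitary n lam, pentagon_heisU n lam, hasUnitaryPartialTranspose_heisU n lam⟩
  have hhat : IsTransposableMultiplicativeUnitary (hatOp (heisj n lam) (heisU n lam)) :=
    ⟨hatOp_mem_unitary hu hU.isUnitary, pentagon_hatOp_heisU n lam, hU.transpose.hatOp hu hsu⟩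
  have hconj := hU.tensorOp_conj hu hsu huu
  -- This is the third operator of the Kac system, and by `tildeOp_eq` it is also the tilde of
  -- `U_A`.
  have htilde := hhat.tensorOp_conj hu hsu huu
  refine ⟨fun ξ => ⟨heisj_eq_heisJhat_heisJ n lam ξ, heisj_eq_heisJ_heisJhat n lam ξ⟩,
    hatOp_hatOp _ _, tildeOp_tildeOp _ _, ?_, hu, huu, hU.isRegular, hhat.isRegular,
    htilde.isRegular, flip_mul_heisj_mul_heisU_pow_three n lam⟩
  rintro X (rfl | rfl | rfl | rfl)
  · exact ⟨hU.isRegular, hU.flip_star.isRegular⟩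
  · exact ⟨hhat.isRegular, hhat.flip_star.isRegular⟩
  · rw [tildeOp_eq _ _ huu]
    exact ⟨htilde.isRegular, htilde.flip_star.isRegular⟩
  · exact ⟨hconj.isRegular, hconj.flip_star.isRegular⟩
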